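/- Let $\mathbb{X}$ be a Polish space with its Borel $\sigma$-field, and let $\mathcal{P}_{\mathbb{X}}$ be the space of Borel probability measures on $\mathbb{X}$ with the Borel $\sigma$-field of the topology of weak convergence. On a probability space $(\Omega,\mathscr{F},\mathbb{P})$ let $\{W_n, n\ge 1\}$ be independent real random variables with $W_1=1$ almost surely and $W_n\sim\mathrm{Beta}(1,n-1)$ for $n\ge 2$, and let $\{Z_n, n\ge1\}$ be an exchangeable sequence of $\mathbb{X}$-valued random variables (for every $n$ the law of $(Z_1,\dots,Z_n)$ is invariant under permutations of the indices), the sequence $\{Z_n\}$ being independent of the sequence $\{W_n\}$. Let $\{Q_n,n\ge1\}$ be $\mathcal{P}_{\mathbb{X}}$-valued with, almost surely, $$Q_n=W_n\,\delta_{Z_n}+(1-W_n)\,Q_{n-1},\qquad n\ge 1,$$ where $Q_0$ is arbitrary (it is irrelevant, as $W_1=1$ almost surely). Then: (i) Put $q_i^{(n)}=W_i\prod_{j=i+1}^{n}(1-W_j)$ for $1\le i\le n$ and $q^{(n)}=(q^{(n)}_1,\dots,q^{(n)}_n)$. Almost surely, for all $n\ge1$, $q^{(n)}_i\ge 0$,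 $\sum_{i=1}^n q^{(n)}_i=1$ and $$Q_n=\sum_{i=1}^n q_i^{(n)}\delta_{Z_i}.$$ For every $n\ge1$ the vector $q^{(n)}$ has the Dirichlet distribution with parameter $(1,\dots,1)$, i.e. the law of $\bigl(\lambda_i/\sum_{j=1}^n\lambda_j\bigr)_{1\le i\le n}$ with $\lambda_1,\dots,\lambda_n$ independent standard exponential. The sequences $\{q^{(n)},n\ge1\}$ and $\{Z_n,n\ge1\}$ are independent. (ii) There is a random probability measure $Q$ on $(\Omega,\mathscr{F},\mathbb{P})$, that is, a measurable map $Q:\Omega\to\mathcal{P}_{\mathbb{X}}$, such that, for $\mathbb{P}$-almost every $\omega$, $Q_n(\omega)$ converges weakly to $Q(\omega)$ as $n\to\infty$. The law of $Q$ is the de Finetti measure of $\{Z_n\}$, that is, the unique probability measure $\nu$ on $\mathcal{P}_{\mathbb{X}}$ with $$\mathbb{P}(Z_1\in A_1,\dots,Z_n\in A_n)=\int_{\mathcal{P}_{\mathbb{X}}}\prod_{i=1}^n\mu(A_i)\,\nu(d\mu)$$ for all $n\ge1$ and all Borel sets $A_1,\dots,A_n\subseteq\mathbb{X}$. -/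

import Mathlib

open MeasureTheory ProbabilityTheory Filter Topology

theorem nhds_generateFrom_isCountablyGenerated {α : Type*} {S : Set (Set α)} (hS : S.Countable)
    (x : α) : (@nhds α (TopologicalSpace.generateFrom S) x).IsCountablyGenerated := by
  let t : TopologicalSpace α := TopologicalSpace.generateFrom S
  have : SecondCountableTopology α := ⟨S, hS, rfl⟩
  exact FirstCountableTopology.nhds_generated_countable x

theorem mem_nhds_generateFrom {α : Type*} {S : Set (Set α)} {s : Set α} (hs : s ∈ S)
    {x : α} (hx : x ∈ s) : s ∈ @nhds α (TopologicalSpace.generateFrom S) x := by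
  let t : TopologicalSpace α := TopologicalSpace.generateFrom S
  exact (TopologicalSpace.isOpen_generateFrom_of_mem hs).mem_nhds hx

/-- On a separable metrizable space, the `σ`-algebra that Mathlib puts on `ProbabilityMeasure X`
(generated by the evaluations `μ ↦ μ A`) is the Borel `σ`-algebra of the topology of weak
convergence. -/
instance instBorelSpaceProbabilityMeasure (X : Type*) [TopologicalSpace X]
    [TopologicalSpace.PseudoMetrizableSpace X] [SecondCountableTopology X] [MeasurableSpace X]
    [BorelSpace X] : BorelSpace (ProbabilityMeasure X) := by
  constructor
  let : PseudoMetricSpace X := TopologicalSpace.pseudoMetrizableSpacePseudoMetric X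
  have lsc : ∀ G : Set X, IsOpen G → ∀ c : ENNReal,
      IsOpen {μ : ProbabilityMeasure X | c < (μ : Measure X) G} := by
    intro G hG c
    rw [isOpen_iff_mem_nhds]
    intro μ hμ
    have h := ProbabilityMeasure.le_liminf_measure_open_of_tendsto
      (μ := μ) (μs := id) (L := 𝓝 μ) tendsto_id hG
    exact eventually_lt_of_lt_liminf (lt_of_lt_of_le hμ h)
  apply le_antisymm
  · -- evaluations are Borel
    have key : @Measurable _ _ (borel (ProbabilityMeasure X)) _
        (fun μ : ProbabilityMeasure X => (μ : Measure X)) := by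
      let : MeasurableSpace (ProbabilityMeasure X) := borel _
      have : BorelSpace (ProbabilityMeasure X) := ⟨rfl⟩
      refine Measurable.measure_of_isPiSystem_of_isProbabilityMeasure
        (S := {G : Set X | IsOpen G}) (BorelSpace.measurable_eq (α := X)) isPiSystem_isOpen ?_
      intro G hG
      exact measurable_of_Ioi fun c => (lsc G hG c).measurableSet
    exact measurable_iff_comap_le.1 key
  · -- weakly open sets are generated by countably many evaluation sets
    set B := TopologicalSpace.countableBasis X
    set 𝓤 : Set (Set X) := Set.sUnion '' {s : Set (Set X) | s.Finite ∧ s ⊆ B}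
    have h𝓤 : 𝓤.Countable :=
      (Set.countable_ofPred_finite_subset (TopologicalSpace.countable_countableBasis X)).image _
    have h𝓤o : ∀ U ∈ 𝓤, IsOpen U := by
      rintro U ⟨s, ⟨-, hs⟩, rfl⟩
      exact isOpen_sUnion fun t ht => TopologicalSpace.isOpen_of_mem_countableBasis (hs ht)
    set S : Set (Set (ProbabilityMeasure X)) :=
      (fun p : Set X × ℚ => {μ : ProbabilityMeasure X | ENNReal.ofReal p.2 < (μ : Measure X) p.1})
        '' (𝓤 ×ˢ Set.univ)
    have hS : S.Countable := (h𝓤.prod Set.countable_univ).image _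
    have hle : TopologicalSpace.generateFrom S
        ≤ (inferInstance : TopologicalSpace (ProbabilityMeasure X)) := by
      refine le_of_nhds_le_nhds fun μ => ?_
      have := nhds_generateFrom_isCountablyGenerated hS μ
      change Tendsto (fun ν : ProbabilityMeasure X => ν) (@nhds _ (TopologicalSpace.generateFrom S) μ) (𝓝 μ)
      refine tendsto_of_forall_isOpen_le_liminf' (μ := μ) (L := @nhds _ (TopologicalSpace.generateFrom S) μ) fun G hG => ?_
      refine le_of_forall_lt fun c hc => ?_
      obtain ⟨T, hTB, hGT⟩ :=
        (TopologicalSpace.isBasis_countableBasis X).open_eq_sUnion hG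
      have : Countable T :=
        ((TopologicalSpace.countable_countableBasis X).mono hTB).to_subtype
      have hdir : Directed (· ⊆ ·) (fun s : Finset T => ⋃ i ∈ s, (i : Set X)) := by
        classical
        intro s t
        exact ⟨s ∪ t, Set.biUnion_subset_biUnion_left fun x hx => Finset.mem_union_left _ hx,
          Set.biUnion_subset_biUnion_left fun x hx => Finset.mem_union_right _ hx⟩
      have hU : G = ⋃ s : Finset T, ⋃ i ∈ s, (i : Set X) := by
        rw [hGT]
        ext x
        simp only [Set.mem_sUnion, Set.mem_iUnion]
        constructor
        · rintro ⟨t, ht, hx⟩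
          exact ⟨{⟨t, ht⟩}, ⟨t, ht⟩, by simp, hx⟩
        · rintro ⟨s, i, -, hx⟩
          exact ⟨i, i.2, hx⟩
      have hc' := hc
      rw [hU, hdir.measure_iUnion, lt_iSup_iff] at hc'
      obtain ⟨s, hs⟩ := hc'
      obtain ⟨q, -, hq1, hq2⟩ := ENNReal.lt_iff_exists_rat_btwn.1 hs
      have hmem : (⋃ i ∈ s, (i : Set X)) ∈ 𝓤 := by
        refine ⟨(fun i : T => (i : Set X)) '' (s : Set T), ⟨s.finite_toSet.image _, ?_⟩, ?_⟩
        · rintro _ ⟨i, -, rfl⟩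
          exact hTB i.2
        · simp
      have hsub : (⋃ i ∈ s, (i : Set X)) ⊆ G := by
        rw [hU]
        exact Set.subset_iUnion (fun s : Finset T => ⋃ i ∈ s, (i : Set X)) s
      refine lt_of_lt_of_le hq1 (le_liminf_of_le (by isBoundedDefault) ?_)
      have hmS : {ν : ProbabilityMeasure X |
          ENNReal.ofReal (q : ℝ) < (ν : Measure X) (⋃ i ∈ s, (i : Set X))} ∈ S :=
        ⟨(_, q), ⟨hmem, trivial⟩, rfl⟩
      filter_upwards [mem_nhds_generateFrom hmS (x := μ) hq2] with ν hν
      exact (le_of_lt hν).trans (measure_mono hsub)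
    have hb : borel (ProbabilityMeasure X)
        ≤ @borel (ProbabilityMeasure X) (TopologicalSpace.generateFrom S) :=
      borel_anti hle
    refine hb.trans ?_
    let t' : TopologicalSpace (ProbabilityMeasure X) := TopologicalSpace.generateFrom S
    have : @SecondCountableTopology _ t' := ⟨S, hS, rfl⟩
    rw [@borel_eq_generateFrom_of_subbasis _ S t' _ rfl]
    refine MeasurableSpace.generateFrom_le ?_
    rintro _ ⟨⟨U, q⟩, ⟨hU, -⟩, rfl⟩
    exact measurableSet_lt measurable_const
      ((Measure.measurable_coe (h𝓤o U hU).measurableSet).comp measurable_subtype_coe)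

/-- The Dirichlet distribution with parameters `(α i)`: the law of the vector obtained by dividing
independent `Gamma (α i, 1)` variables by their sum. -/
noncomputable def dirichletMeasure {ι : Type*} [Fintype ι] (α : ι → ℝ) : Measure (ι → ℝ) :=
  (Measure.pi fun i => gammaMeasure (α i) 1).map fun x i => x i / ∑ j, x j

/-- A sequence of random variables is exchangeable if, for every `n`, the law of its first `n`
terms is invariant under every permutation of the indices. -/
def Exchangeable {Ω X : Type*} [MeasurableSpace Ω] [MeasurableSpace X]
    (Z : ℕ → Ω → X) (P : Measure Ω) : Prop :=
  ∀ (n : ℕ) (σ : Equiv.Perm (Fin n)),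
    IdentDistrib (fun ω (i : Fin n) => Z (σ i) ω) (fun ω (i : Fin n) => Z i ω) P P

/-- `ν` is a de Finetti measure (mixing measure) of the sequence `Z`: a probability measure on the
space of probability measures such that `Z` is a `ν`-mixture of i.i.d. sequences, that is,
`P (Z 0 ∈ A 0, …, Z (n - 1) ∈ A (n - 1)) = ∫ μ (A 0) ⋯ μ (A (n - 1)) ν(dμ)`. -/
structure IsDeFinettiMeasure {Ω X : Type*} [MeasurableSpace Ω] [MeasurableSpace X]
    (ν : Measure (ProbabilityMeasure X)) (Z : ℕ → Ω → X) (P : Measure Ω) : Prop where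
  isProbabilityMeasure : IsProbabilityMeasure ν
  measure_eq : ∀ (n : ℕ) (A : Fin n → Set X), (∀ i, MeasurableSet (A i)) →
    P {ω | ∀ i : Fin n, Z i ω ∈ A i} = ∫⁻ μ, ∏ i : Fin n, (μ : Measure X) (A i) ∂ν

/-- The weights `w i * ∏_{i < j < n} (1 - w j)`, `i = 0, …, n - 1`, obtained by iterating `n`
times the step "multiply by `1 - w` and add a new term of weight `w`". -/
def mixingWeights (w : ℕ → ℝ) (n : ℕ) (i : Fin n) : ℝ :=
  w i * ∏ j ∈ Finset.Ioo (i : ℕ) n, (1 - w j)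

/-! Part (i) is Beta–Gamma algebra. For independent standard exponentials with partial sums `S n`,
the normalized vector of the first `n` is independent of `S n`. Adding one more exponential
multiplies this vector by `1 - w` and appends `w`, its share of the new sum. This share has law
Beta(1, n) and is independent of the old vector and of the new sum. The weights obey the same
recursion, so their law is Dirichlet (`map_normalizeSum_succ`, `hasLaw_mixingWeights`).

Part (ii) rests on one second-moment bound, `Exchangeable.integral_sq_sum_le`. If the weights `a i`
sum to zero and are independent of `Z`, and `f` takes values in [0, 1], then E(∑ a i f(Z i))² ≤ E ∑
(a i)², because exchangeability leaves a single off-diagonal covariance, which the zero sum cancels.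
The bound is used twice: to compare empirical averages of two lengths, and to compare the average
under `Q n` with the empirical average of length `n`. Both errors are of order 1/n, hence summable
along fourth powers, and almost sure convergence follows there. Between consecutive fourth powers `Q
n` of a set moves by at most a block sum of the `W k`, which tends to zero.

The limits of averages are conditional probabilities given the tail σ-algebra, hence values of a
regular conditional distribution `κ`. Swapping indices shows that the terms are conditionally
independent given the tail, so the law of `κ` is a de Finetti measure
(`Exchangeable.exists_directing`). Countably many sets suffice for weak convergence, and mixed
moments determine the law, which gives uniqueness. -/

/-! ### Beta–Gamma algebra and Beta moments -/

theorem lintegral_eq_ofReal_abs_mul_lintegral_comp_mul_left {y : ℝ} (hy : y ≠ 0) {f : ℝ → ENNReal}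
    (hf : Measurable f) : ∫⁻ t, f t = ENNReal.ofReal |y| * ∫⁻ u, f (y * u) := by
  conv_lhs => rw [← Real.smul_map_volume_mul_left hy]
  rw [lintegral_smul_measure, lintegral_map hf (by fun_prop), smul_eq_mul]

theorem measurable_betaPDF (a b : ℝ) : Measurable (betaPDF a b) :=
  (measurable_betaPDFReal a b).ennreal_ofReal

theorem measurable_gammaPDF (a r : ℝ) : Measurable (gammaPDF a r) :=
  (measurable_gammaPDFReal a r).ennreal_ofReal

/-- The density identity for the substitution `(s, t) = (y(1 - u), y u)`, whose Jacobian is `|y|`.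
The endpoints are excluded because the Beta density is set to zero there, while a Gamma density of
shape 1 is not zero at 0. -/
theorem gammaPDF_mul_gammaPDF {a b r y u : ℝ} (ha : 0 < a) (hb : 0 < b) (hr : 0 < r) (hy : 0 < y)
    (hu0 : u ≠ 0) (hu1 : u ≠ 1) :
    ENNReal.ofReal |y| * (gammaPDF a r (y - y * u) * gammaPDF b r (y * u)) =
      betaPDF b a u * gammaPDF (a + b) r y := by
  by_cases h0 : u < 0
  · rw [gammaPDF_of_neg (mul_neg_of_pos_of_neg hy h0), betaPDF_eq_zero_of_nonpos h0.le]
    simp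
  by_cases h1 : 1 < u
  · rw [gammaPDF_of_neg (show y - y * u < 0 by nlinarith), betaPDF_eq_zero_of_one_le h1.le]
    simp
  have hu0 : 0 < u := lt_of_le_of_ne (not_lt.1 h0) hu0.symm
  have hu1 : 0 < 1 - u := sub_pos.2 (lt_of_le_of_ne (not_lt.1 h1) hu1)
  have e : y - y * u = y * (1 - u) := by ring
  rw [e, gammaPDF_of_nonneg (by positivity), gammaPDF_of_nonneg (by positivity),
    gammaPDF_of_nonneg hy.le, betaPDF_of_pos_lt_one hu0 (by linarith), abs_of_pos hy,
    ← ENNReal.ofReal_mul (by positivity), ← ENNReal.ofReal_mul hy.le, ← ENNReal.ofReal_mul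
      (mul_nonneg (mul_nonneg (one_div_nonneg.2 (beta_pos hb ha).le) (by positivity))
        (by positivity))]
  congr 1
  have hA := (Real.Gamma_pos_of_pos ha).ne'
  have hB := (Real.Gamma_pos_of_pos hb).ne'
  have hAB := (Real.Gamma_pos_of_pos (add_pos ha hb)).ne'
  rw [beta, add_comm b a, Real.mul_rpow hy.le hu1.le, Real.mul_rpow hy.le hu0.le,
    Real.rpow_add hr, show a + b - 1 = (a - 1) + (b - 1) + 1 by ring, Real.rpow_add hy,
    Real.rpow_add hy, Real.rpow_one,
    show -(r * y) = -(r * (y * (1 - u))) + -(r * (y * u)) by ring, Real.exp_add]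
  field_simp

/-- If `S` and `T` are independent with Gamma distributions of shapes `a` and `b`, then
`T / (S + T)` and `S + T` are independent with distributions `Beta b a` and `Gamma (a + b)`. -/
theorem map_prod_gammaMeasure {a b r : ℝ} (ha : 0 < a) (hb : 0 < b) (hr : 0 < r) :
    ((gammaMeasure a r).prod (gammaMeasure b r)).map (fun p => (p.2 / (p.1 + p.2), p.1 + p.2)) =
      (betaMeasure b a).prod (gammaMeasure (a + b) r) := by
  have := isProbabilityMeasure_gammaMeasure ha hr
  have := isProbabilityMeasure_gammaMeasure hb hr
  have := isProbabilityMeasure_gammaMeasure (add_pos ha hb) hr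
  have := isProbabilityMeasureBeta hb ha
  have hg : ∀ c, Measurable (gammaPDF c r) := fun c => measurable_gammaPDF c r
  have hbt := measurable_betaPDF b a
  refine Measure.ext_of_lintegral _ fun f hf => ?_
  rw [lintegral_map hf (by fun_prop), lintegral_prod_symm _ (by fun_prop),
    lintegral_prod_symm _ (by fun_prop)]
  simp only [gammaMeasure, betaMeasure]
  rw [lintegral_withDensity_eq_lintegral_mul _ (hg b) (by fun_prop),
    lintegral_withDensity_eq_lintegral_mul _ (hg (a + b)) (by fun_prop)]
  -- For fixed `t` the inner variable becomes the sum `y = s + t`; after swapping the integrals, `t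
  -- = y u` for fixed `y`.
  have h1 : ∀ t, (gammaPDF b r * fun t => ∫⁻ s, f (t / (s + t), s + t)
        ∂(volume.withDensity (gammaPDF a r))) t =
      ∫⁻ y, gammaPDF b r t * (gammaPDF a r (y - t) * f (t / y, y)) := by
    intro t
    rw [Pi.mul_apply, lintegral_withDensity_eq_lintegral_mul _ (hg a) (by fun_prop),
      lintegral_const_mul _ (by fun_prop),
      ← lintegral_sub_right_eq_self _ t]
    simp
  simp_rw [h1]
  rw [lintegral_lintegral_swap (by fun_prop)]
  refine lintegral_congr_ae ?_
  filter_upwards [Measure.ae_ne volume (0 : ℝ)] with y hy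
  rw [Pi.mul_apply, lintegral_withDensity_eq_lintegral_mul _ hbt (by fun_prop)]
  rcases lt_or_gt_of_ne hy with hy | hy
  · rw [gammaPDF_of_neg hy, zero_mul, lintegral_eq_zero_iff (by fun_prop)]
    refine Eventually.of_forall fun t => ?_
    by_cases ht : t < 0
    · simp [gammaPDF_of_neg ht]
    · simp [gammaPDF_of_neg (show y - t < 0 by linarith)]
  · rw [lintegral_eq_ofReal_abs_mul_lintegral_comp_mul_left hy.ne' (by fun_prop),
      ← lintegral_const_mul _ (by fun_prop), ← lintegral_const_mul _ (by fun_prop)]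
    refine lintegral_congr_ae ?_
    filter_upwards [Measure.ae_ne volume (0 : ℝ), Measure.ae_ne volume (1 : ℝ)] with u h0 h1
    rw [mul_div_cancel_left₀ _ hy.ne', Pi.mul_apply, ← mul_assoc (gammaPDF (a + b) r y),
      mul_comm (gammaPDF (a + b) r y), ← gammaPDF_mul_gammaPDF ha hb hr hy h0 h1]
    ring

theorem ae_mem_Ioo_betaMeasure (a b : ℝ) : ∀ᵐ x ∂betaMeasure a b, x ∈ Set.Ioo (0 : ℝ) 1 := by
  rw [betaMeasure, ae_withDensity_iff (measurable_betaPDF a b)]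
  refine Eventually.of_forall fun x hx => ⟨?_, ?_⟩
  · by_contra h
    exact hx (betaPDF_eq_zero_of_nonpos (not_lt.1 h))
  · by_contra h
    exact hx (betaPDF_eq_zero_of_one_le (not_lt.1 h))

theorem ae_pos_gammaMeasure (a r : ℝ) : ∀ᵐ x ∂gammaMeasure a r, 0 < x := by
  rw [gammaMeasure, ae_withDensity_iff (measurable_gammaPDF a r)]
  filter_upwards [Measure.ae_ne volume (0 : ℝ)] with x h0 hx
  by_contra h
  exact hx (gammaPDF_of_neg (lt_of_le_of_ne (not_lt.1 h) h0))

/-- Multiplying the Beta(a, b) density by `x ^ p * (1 - x) ^ q` gives a multiple of the Beta(a + p,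
b + q) density, which integrates to 1. -/
theorem integral_rpow_mul_rpow_betaMeasure {a b p q : ℝ} (ha : 0 < a) (hb : 0 < b) (hp : 0 ≤ p)
    (hq : 0 ≤ q) :
    ∫ x, x ^ p * (1 - x) ^ q ∂betaMeasure a b = beta (a + p) (b + q) / beta a b := by
  have h1 := beta_pos ha hb
  have h2 := beta_pos (show 0 < a + p by linarith) (show 0 < b + q by linarith)
  have hint : ∫ x, betaPDFReal (a + p) (b + q) x = 1 := by
    rw [integral_eq_lintegral_of_nonneg_ae _ (by fun_prop)]
    · exact (ENNReal.toReal_eq_one_iff _).2 (lintegral_betaPDF_eq_one (by linarith) (by linarith))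
    · refine Eventually.of_forall fun x => ?_
      by_cases hx : 0 < x ∧ x < 1
      · exact (betaPDFReal_pos hx.1 hx.2 (by linarith) (by linarith)).le
      · simp [betaPDFReal, hx]
  rw [betaMeasure, integral_withDensity_eq_integral_toReal_smul
    (measurable_betaPDF a b) (by simp [betaPDF])]
  calc ∫ x, (betaPDF a b x).toReal • (x ^ p * (1 - x) ^ q)
      = ∫ x, beta (a + p) (b + q) / beta a b * betaPDFReal (a + p) (b + q) x := by
        refine integral_congr_ae (Eventually.of_forall fun x => ?_)
        by_cases hx : 0 < x ∧ x < 1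
        · have h3 : 0 < 1 - x := by linarith
          simp only [betaPDF, ENNReal.toReal_ofReal (betaPDFReal_pos hx.1 hx.2 ha hb).le, smul_eq_mul]
          rw [betaPDFReal, betaPDFReal, if_pos hx, if_pos hx,
            show a + p - 1 = (a - 1) + p by ring, show b + q - 1 = (b - 1) + q by ring,
            Real.rpow_add hx.1, Real.rpow_add h3]
          field_simp
        · simp [betaPDF, betaPDFReal, hx]
    _ = _ := by rw [integral_const_mul, hint, mul_one]

theorem integral_sq_betaMeasure_one {n : ℕ} (hn : 1 ≤ n) :
    ∫ x, x ^ 2 ∂betaMeasure 1 n = 2 / ((n + 1) * (n + 2)) := by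
  have hn' : (0 : ℝ) < n := by exact_mod_cast hn
  have h := integral_rpow_mul_rpow_betaMeasure one_pos hn' (zero_le_two) (le_refl (0 : ℝ))
  simp only [Real.rpow_two, Real.rpow_zero, mul_one] at h
  rw [h, beta, beta, show (1 : ℝ) + 2 + (n + 0) = ((1 + n) + 1) + 1 by ring,
    show (1 : ℝ) + 2 = 1 + 1 + 1 by norm_num, Real.Gamma_add_one (s := 1 + n + 1) (by positivity),
    Real.Gamma_add_one (s := 1 + n) (by positivity), Real.Gamma_add_one (s := 1 + 1) (by positivity),
    Real.Gamma_add_one (s := 1) (by positivity), Real.Gamma_one, add_zero]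
  have := (Real.Gamma_pos_of_pos hn').ne'
  have := (Real.Gamma_pos_of_pos (show (0 : ℝ) < 1 + n by positivity)).ne'
  field_simp
  ring

theorem integral_one_sub_sq_betaMeasure_one {n : ℕ} (hn : 1 ≤ n) :
    ∫ x, (1 - x) ^ 2 ∂betaMeasure 1 n = (n : ℝ) / (n + 2) := by
  have hn' : (0 : ℝ) < n := by exact_mod_cast hn
  have h := integral_rpow_mul_rpow_betaMeasure one_pos hn' (le_refl (0 : ℝ)) (zero_le_two)
  simp only [Real.rpow_two, Real.rpow_zero, one_mul] at h
  rw [h, beta, beta, show (1 : ℝ) + 0 + (n + 2) = ((n + 1) + 1) + 1 by ring,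
    show (n : ℝ) + 2 = n + 1 + 1 by ring, add_comm (1 : ℝ) n, Real.Gamma_add_one (s := n + 1 + 1) (by positivity),
    Real.Gamma_add_one (s := n + 1) (by positivity),
    Real.Gamma_add_one (s := n) (by positivity), add_zero, Real.Gamma_one]
  have := (Real.Gamma_pos_of_pos hn').ne'
  field_simp

/-! ### Algebra of the mixing weights -/

theorem mixingWeights_last (w : ℕ → ℝ) (n : ℕ) : mixingWeights w (n + 1) (Fin.last n) = w n := by
  have h : Finset.Ioo n (n + 1) = ∅ := by
    ext k
    simp only [Finset.mem_Ioo, Finset.notMem_empty, iff_false]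
    omega
  simp [mixingWeights, h]

theorem mixingWeights_one (w : ℕ → ℝ) (i : Fin 1) : mixingWeights w 1 i = w 0 := by
  rw [Subsingleton.elim i (Fin.last 0), mixingWeights_last]

/-- The inductions for the total mass, the Dirichlet law and the second moment of the weights all
run on this recursion. -/
theorem mixingWeights_succ (w : ℕ → ℝ) (n : ℕ) :
    mixingWeights w (n + 1) =
      Fin.snoc (α := fun _ => ℝ) ((1 - w n) • mixingWeights w n) (w n) := by
  funext i
  refine Fin.lastCases ?_ (fun i => ?_) i
  · rw [Fin.snoc_last, mixingWeights_last]
  · rw [Fin.snoc_castSucc]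
    have h : Finset.Ioo (i : ℕ) (n + 1) = insert n (Finset.Ioo (i : ℕ) n) := by
      ext k
      simp only [Finset.mem_Ioo, Finset.mem_insert]
      omega
    simp only [mixingWeights, Fin.val_castSucc, h, Pi.smul_apply, smul_eq_mul]
    rw [Finset.prod_insert (by simp)]
    ring

theorem measurable_mixingWeights (n : ℕ) : Measurable fun w : ℕ → ℝ => mixingWeights w n := by
  unfold mixingWeights
  fun_prop

theorem mixingWeights_nonneg {w : ℕ → ℝ} (h : ∀ k, 0 ≤ w k ∧ w k ≤ 1) (n : ℕ) (i : Fin n) :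
    0 ≤ mixingWeights w n i :=
  mul_nonneg (h i).1 (Finset.prod_nonneg fun j _ => sub_nonneg.2 (h j).2)

theorem sum_mixingWeights {w : ℕ → ℝ} (h0 : w 0 = 1) {n : ℕ} (hn : 1 ≤ n) :
    ∑ i, mixingWeights w n i = 1 := by
  induction n, hn using Nat.le_induction with
  | base => simp [mixingWeights_one, h0]
  | succ n hn ih =>
    rw [mixingWeights_succ, Fin.sum_univ_castSucc]
    simp only [Fin.snoc_castSucc, Fin.snoc_last, Pi.smul_apply, smul_eq_mul]
    rw [← Finset.mul_sum, ih]
    ring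

/-- Iterating `m ↦ w n • δ (z n) + (1 - w n) • m`. -/
theorem eq_sum_mixingWeights_dirac {X : Type*} [MeasurableSpace X] {w : ℕ → ℝ} {z : ℕ → X}
    {m : ℕ → Measure X} (h : ∀ k, 0 ≤ w k ∧ w k ≤ 1) (h0 : w 0 = 1)
    (hm : ∀ n, m (n + 1) = ENNReal.ofReal (w n) • Measure.dirac (z n) +
      ENNReal.ofReal (1 - w n) • m n) {n : ℕ} (hn : 1 ≤ n) :
    m n = ∑ i : Fin n, ENNReal.ofReal (mixingWeights w n i) • Measure.dirac (z i) := by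
  induction n, hn using Nat.le_induction with
  | base => simp [mixingWeights_one, hm, h0]
  | succ n hn ih =>
    rw [mixingWeights_succ, Fin.sum_univ_castSucc, hm, ih, add_comm, Finset.smul_sum]
    simp only [Fin.snoc_castSucc, Fin.snoc_last, Pi.smul_apply, smul_eq_mul, Fin.val_castSucc,
      Fin.val_last, smul_smul]
    congr 1
    refine Finset.sum_congr rfl fun i _ => ?_
    rw [ENNReal.ofReal_mul (sub_nonneg.2 (h n).2)]

theorem sum_sq_mixingWeights_succ (w : ℕ → ℝ) (n : ℕ) :
    ∑ i, mixingWeights w (n + 1) i ^ 2 =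
      (1 - w n) ^ 2 * ∑ i, mixingWeights w n i ^ 2 + w n ^ 2 := by
  rw [mixingWeights_succ, Fin.sum_univ_castSucc]
  simp [mul_pow, Finset.mul_sum]

/-! ### The Dirichlet law of the weights -/

/-- The pair formed by the normalization of a vector and its sum. -/
noncomputable def normalizeSum (n : ℕ) (x : Fin n → ℝ) : (Fin n → ℝ) × ℝ :=
  (fun i => x i / ∑ j, x j, ∑ j, x j)

theorem measurable_normalizeSum (n : ℕ) : Measurable (normalizeSum n) := by
  unfold normalizeSum
  fun_prop

/-- Append `w` to the vector `(1 - w) • y`. -/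
noncomputable def mixSnoc (n : ℕ) (p : (Fin n → ℝ) × ℝ) : Fin (n + 1) → ℝ :=
  Fin.snoc (α := fun _ => ℝ) ((1 - p.2) • p.1) p.2

theorem measurable_fin_snoc (n : ℕ) :
    Measurable fun p : (Fin n → ℝ) × ℝ => (Fin.snoc (α := fun _ => ℝ) p.1 p.2 : Fin (n + 1) → ℝ) := by
  refine measurable_pi_lambda _ fun i => ?_
  refine Fin.lastCases ?_ (fun i => ?_) i
  · simp only [Fin.snoc_last]
    fun_prop
  · simp only [Fin.snoc_castSucc]
    fun_prop

theorem measurable_mixSnoc (n : ℕ) : Measurable (mixSnoc n) :=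
  (measurable_fin_snoc n).comp (by fun_prop : Measurable fun p : (Fin n → ℝ) × ℝ =>
    ((1 - p.2) • p.1, p.2))

theorem map_snoc_pi_prod {n : ℕ} (μ : Measure ℝ) [SigmaFinite μ] :
    ((Measure.pi fun _ : Fin n => μ).prod μ).map
      (fun p => (Fin.snoc (α := fun _ => ℝ) p.1 p.2 : Fin (n + 1) → ℝ)) =
      Measure.pi fun _ : Fin (n + 1) => μ := by
  have h := (measurePreserving_piFinSuccAbove (fun _ : Fin (n + 1) => μ) (Fin.last n)).symm
  rw [← h.map_eq, ← Measure.prod_swap, Measure.map_map (by fun_prop) measurable_swap]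
  congr 1
  funext p
  simp [MeasurableEquiv.piFinSuccAbove, Fin.insertNthEquiv]

theorem fst_map_normalizeSum (n : ℕ) :
    ((Measure.pi fun _ : Fin n => gammaMeasure 1 1).map (normalizeSum n)).fst =
      dirichletMeasure fun _ : Fin n => 1 := by
  rw [Measure.fst, Measure.map_map measurable_fst (measurable_normalizeSum n)]
  rfl

/-- As soon as the joint law of normalized vector and sum is known to be some product, its first
marginal identifies the first factor. -/
theorem dirichletMeasure_eq_of_map_normalizeSum {n : ℕ} {A : Measure (Fin n → ℝ)} {B : Measure ℝ}
    [SFinite A] [IsProbabilityMeasure B]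
    (h : (Measure.pi fun _ : Fin n => gammaMeasure 1 1).map (normalizeSum n) = A.prod B) :
    (dirichletMeasure fun _ : Fin n => 1) = A := by
  rw [← fst_map_normalizeSum, h, Measure.fst_prod]

theorem map_normalizeSum_one :
    (Measure.pi fun _ : Fin 1 => gammaMeasure 1 1).map (normalizeSum 1) =
      (Measure.dirac fun _ => 1).prod (gammaMeasure 1 1) := by
  have := isProbabilityMeasure_gammaMeasure one_pos one_pos
  have h := measurePreserving_eval (fun _ : Fin 1 => gammaMeasure 1 1) 0
  rw [Measure.dirac_prod]
  conv_rhs => rw [← h.map_eq]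
  rw [Measure.map_map (by fun_prop) h.measurable]
  refine Measure.map_congr ?_
  filter_upwards [ae_of_ae_map h.measurable.aemeasurable (h.map_eq ▸ ae_pos_gammaMeasure 1 1)]
    with x hx
  ext i
  · simp [normalizeSum, Subsingleton.elim i 0, div_self (ne_of_gt hx)]
  · simp [normalizeSum]

/-- The old vector is independent of the old sum and of the new exponential, hence of the pair
(share of the new exponential, new sum), whose two entries are themselves independent by
`map_prod_gammaMeasure`. -/
theorem map_normalizeSum_succ {n : ℕ} (hn : 1 ≤ n) {A : Measure (Fin n → ℝ)}
    [IsProbabilityMeasure A]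
    (h : (Measure.pi fun _ : Fin n => gammaMeasure 1 1).map (normalizeSum n) =
      A.prod (gammaMeasure n 1)) :
    (Measure.pi fun _ : Fin (n + 1) => gammaMeasure 1 1).map (normalizeSum (n + 1)) =
      ((A.prod (betaMeasure 1 n)).map (mixSnoc n)).prod (gammaMeasure ((n + 1 : ℕ) : ℝ) 1) := by
  have hn' : (0 : ℝ) < n := by exact_mod_cast hn
  have hn1 : (0 : ℝ) < (n : ℝ) + 1 := by positivity
  have := isProbabilityMeasure_gammaMeasure one_pos one_pos
  have := isProbabilityMeasure_gammaMeasure hn' one_pos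
  have := isProbabilityMeasure_gammaMeasure hn1 one_pos
  have := isProbabilityMeasureBeta one_pos hn'
  have hN := measurable_normalizeSum n
  have hbg : Measurable fun p : ℝ × ℝ => (p.2 / (p.1 + p.2), p.1 + p.2) := by fun_prop
  -- Reassociate so that the old sum stands next to the new variable, apply the Beta–Gamma map to
  -- that pair, and reassociate back.
  have key : (A.prod (betaMeasure 1 n)).prod (gammaMeasure ((n : ℝ) + 1) 1) =
      ((Measure.pi fun _ : Fin n => gammaMeasure 1 1).prod (gammaMeasure 1 1)).map
        (MeasurableEquiv.prodAssoc.symm ∘ Prod.map id (fun p : ℝ × ℝ => (p.2 / (p.1 + p.2), p.1 + p.2)) ∘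
          MeasurableEquiv.prodAssoc ∘ Prod.map (normalizeSum n) id) := by
    rw [← Measure.map_map (by fun_prop) (by fun_prop), ← Measure.map_map (by fun_prop) (by fun_prop),
      ← Measure.map_map (by fun_prop) (by fun_prop),
      ← Measure.map_prod_map _ _ hN measurable_id, h, Measure.map_id, Measure.prodAssoc_prod,
      ← Measure.map_prod_map _ _ measurable_id hbg, map_prod_gammaMeasure hn' one_pos one_pos,
      Measure.map_id, ← Measure.prodAssoc_prod, MeasurableEquiv.map_symm_map]
  push_cast
  conv_rhs => rw [← Measure.map_id (μ := gammaMeasure ((n : ℝ) + 1) 1)]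
  rw [Measure.map_prod_map _ _ (measurable_mixSnoc n) measurable_id, key,
    Measure.map_map ((measurable_mixSnoc n).prodMap measurable_id) (by fun_prop),
    ← map_snoc_pi_prod, Measure.map_map (measurable_normalizeSum _) (measurable_fin_snoc n)]
  refine Measure.map_congr ?_
  have h1 : ∀ᵐ x ∂(Measure.pi fun _ : Fin n => gammaMeasure 1 1), 0 < ∑ i, x i := by
    have h2 : (Measure.pi fun _ : Fin n => gammaMeasure 1 1).map (fun x => ∑ i, x i) =
        gammaMeasure n 1 := by
      have := congrArg Measure.snd h
      rwa [Measure.snd_prod, Measure.snd, Measure.map_map measurable_snd hN] at this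
    exact ae_of_ae_map (by fun_prop) (h2 ▸ ae_pos_gammaMeasure n 1)
  filter_upwards [Measure.quasiMeasurePreserving_fst.ae h1,
    Measure.quasiMeasurePreserving_snd.ae (ae_pos_gammaMeasure 1 1)] with p hp1 hp2
  have hp3 := (add_pos hp1 hp2).ne'
  have hs : ∑ j : Fin (n + 1), (Fin.snoc (α := fun _ => ℝ) p.1 p.2 : Fin (n + 1) → ℝ) j =
      ∑ i, p.1 i + p.2 := by
    rw [Fin.sum_univ_castSucc]; simp
  simp only [Function.comp_apply, normalizeSum, hs]
  ext i
  · refine Fin.lastCases ?_ (fun i => ?_) i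
    · simp [mixSnoc, MeasurableEquiv.prodAssoc, normalizeSum]
    · simp only [Fin.snoc_castSucc, mixSnoc, MeasurableEquiv.prodAssoc, MeasurableEquiv.coe_mk,
        MeasurableEquiv.symm_mk, Prod.map, Equiv.prodAssoc, Equiv.coe_fn_mk, Equiv.coe_fn_symm_mk,
        id, Pi.smul_apply, smul_eq_mul, normalizeSum]
      field_simp
      ring
  · simp [MeasurableEquiv.prodAssoc, normalizeSum]

/-- Total mass one is carried along because the inductive step requires a probability measure as
first factor. -/
theorem map_normalizeSum_gamma {n : ℕ} (hn : 1 ≤ n) :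
    IsProbabilityMeasure (dirichletMeasure fun _ : Fin n => 1) ∧
    (Measure.pi fun _ : Fin n => gammaMeasure 1 1).map (normalizeSum n) =
      (dirichletMeasure fun _ : Fin n => 1).prod (gammaMeasure n 1) := by
  induction n, hn using Nat.le_induction with
  | base =>
    have := isProbabilityMeasure_gammaMeasure one_pos one_pos
    have h := map_normalizeSum_one
    rw [dirichletMeasure_eq_of_map_normalizeSum h, h, Nat.cast_one]
    exact ⟨inferInstance, rfl⟩
  | succ n hn ih =>
    have := ih.1
    have h := map_normalizeSum_succ hn ih.2
    have := isProbabilityMeasure_gammaMeasure (show (0 : ℝ) < ((n + 1 : ℕ) : ℝ) by positivity) one_pos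
    have := isProbabilityMeasureBeta one_pos (show (0 : ℝ) < n by exact_mod_cast hn)
    rw [dirichletMeasure_eq_of_map_normalizeSum h, h]
    exact ⟨Measure.isProbabilityMeasure_map (measurable_mixSnoc n).aemeasurable, rfl⟩

theorem dirichletMeasure_one :
    (dirichletMeasure fun _ : Fin 1 => 1) = Measure.dirac fun _ => 1 := by
  have := isProbabilityMeasure_gammaMeasure one_pos one_pos
  exact dirichletMeasure_eq_of_map_normalizeSum map_normalizeSum_one

theorem dirichletMeasure_succ {n : ℕ} (hn : 1 ≤ n) :
    (dirichletMeasure fun _ : Fin (n + 1) => 1) =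
      ((dirichletMeasure fun _ : Fin n => 1).prod (betaMeasure 1 n)).map (mixSnoc n) := by
  have := (map_normalizeSum_gamma hn).1
  have := isProbabilityMeasure_gammaMeasure (show (0 : ℝ) < ((n + 1 : ℕ) : ℝ) by positivity) one_pos
  have := isProbabilityMeasureBeta one_pos (show (0 : ℝ) < n by exact_mod_cast hn)
  exact dirichletMeasure_eq_of_map_normalizeSum (map_normalizeSum_succ hn (map_normalizeSum_gamma hn).2)

theorem indepFun_mixingWeights {Ω : Type*} [MeasurableSpace Ω] {P : Measure Ω}
    {W : ℕ → Ω → ℝ} (hW : ∀ n, Measurable (W n)) (hW_indep : iIndepFun W P) (n : ℕ) :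
    IndepFun (fun ω => mixingWeights (fun k => W k ω) n) (W n) P := by
  have h := hW_indep.indepFun_finset (Finset.range n) {n} (by simp) hW
  -- The weights of order `n` read only the coordinates below `n`, so padding the others with 0 is
  -- harmless.
  have hv : Measurable fun (v : Finset.range n → ℝ) (k : ℕ) =>
      if hk : k ∈ Finset.range n then v ⟨k, hk⟩ else 0 := by
    refine measurable_pi_lambda _ fun k => ?_
    by_cases hk : k ∈ Finset.range n
    · simp only [hk, dite_true]; fun_prop
    · simp only [hk, dite_false]; fun_prop
  have hψ : Measurable fun v : ({n} : Finset ℕ) → ℝ => v ⟨n, Finset.mem_singleton_self n⟩ :=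
    measurable_pi_apply (X := fun _ => ℝ) (⟨n, Finset.mem_singleton_self n⟩ : ({n} : Finset ℕ))
  have h' := h.comp ((measurable_mixingWeights n).comp hv) hψ
  convert h' using 1
  swap; · rfl
  funext ω i
  simp only [mixingWeights, Function.comp_apply]
  congr 1
  · simp
  · refine Finset.prod_congr rfl fun j hj => ?_
    simp [(Finset.mem_Ioo.1 hj).2]

theorem hasLaw_mixingWeights {Ω : Type*} [MeasurableSpace Ω] {P : Measure Ω}
    [IsProbabilityMeasure P] {W : ℕ → Ω → ℝ} (hW : ∀ n, Measurable (W n))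
    (hW_indep : iIndepFun W P) (hW_one : ∀ᵐ ω ∂P, W 0 ω = 1)
    (hW_beta : ∀ n : ℕ, 1 ≤ n → HasLaw (W n) (betaMeasure 1 n) P) {n : ℕ} (hn : 1 ≤ n) :
    HasLaw (fun ω => mixingWeights (fun k => W k ω) n) (dirichletMeasure fun _ : Fin n => 1) P := by
  have hm : ∀ n, Measurable fun ω => mixingWeights (fun k => W k ω) n := fun n =>
    (measurable_mixingWeights n).comp (measurable_pi_lambda _ hW)
  induction n, hn using Nat.le_induction with
  | base =>
    rw [dirichletMeasure_one]
    refine hasLaw_dirac_of_ae_eq ?_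
    filter_upwards [hW_one] with ω h
    ext i
    simp [mixingWeights_one, h]
  | succ n hn ih =>
    refine ⟨(hm _).aemeasurable, ?_⟩
    have h := (indepFun_iff_map_prod_eq_prod_map_map (hm n).aemeasurable (hW n).aemeasurable).1
      (indepFun_mixingWeights hW hW_indep n)
    rw [ih.map_eq, (hW_beta n hn).map_eq] at h
    rw [dirichletMeasure_succ hn, ← h, Measure.map_map (measurable_mixSnoc n)
      ((hm n).prodMk (hW n))]
    congr 1
    funext ω
    exact mixingWeights_succ _ n

/-! ### Second moments of exchangeable sequences -/

theorem Exchangeable.map_swap {Ω X : Type*} [MeasurableSpace Ω] [MeasurableSpace X]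
    {Z : ℕ → Ω → X} {P : Measure Ω} [IsFiniteMeasure P] (h : Exchangeable Z P)
    (hZ : ∀ n, Measurable (Z n)) (i j : ℕ) :
    P.map (fun ω k => Z (Equiv.swap i j k) ω) = P.map fun ω k => Z k ω := by
  have hm : Measurable fun ω k => Z k ω := measurable_pi_lambda _ hZ
  have hm' : Measurable fun ω k => Z (Equiv.swap i j k) ω := measurable_pi_lambda _ fun k => hZ _
  have hu : IsProjectiveLimit (P.map fun ω k => Z k ω)
      fun I => (P.map fun ω k => Z k ω).map (I.restrict (π := fun _ => X)) := fun I => rfl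
  refine IsProjectiveLimit.unique (fun I => ?_) hu
  -- `M` exceeds `i`, `j` and every index in `I`, so the transposition permutes the first `M`
  -- indices and finite exchangeability applies.
  set M := I.sup id + i + j + 1
  have hI : ∀ k : I, (k : ℕ) < M := fun k => by
    have : (k : ℕ) ≤ I.sup id := Finset.le_sup (f := id) k.2
    omega
  have hres : Measurable fun (v : Fin M → X) (k : I) => v ⟨k, hI k⟩ :=
    measurable_pi_lambda _ fun k => measurable_pi_apply _
  have key := ((h M (Equiv.swap ⟨i, by omega⟩ ⟨j, by omega⟩)).comp hres).map_eq
  rw [Measure.map_map (Finset.measurable_restrict I) hm',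
    Measure.map_map (Finset.measurable_restrict I) hm]
  convert key using 2
  swap; · rfl
  funext ω k
  simp only [Function.comp_apply, Finset.restrict, Equiv.swap_apply_def, Fin.ext_iff]
  split_ifs <;> rfl

theorem Exchangeable.integral_comp_swap {Ω X : Type*} [MeasurableSpace Ω] [MeasurableSpace X]
    {Z : ℕ → Ω → X} {P : Measure Ω} [IsFiniteMeasure P] (h : Exchangeable Z P)
    (hZ : ∀ n, Measurable (Z n)) (i j : ℕ) {F : (ℕ → X) → ℝ} (hF : Measurable F) :
    ∫ ω, F (fun k => Z (Equiv.swap i j k) ω) ∂P = ∫ ω, F (fun k => Z k ω) ∂P := by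
  have hm : Measurable fun ω k => Z k ω := measurable_pi_lambda _ hZ
  have hm' : Measurable fun ω k => Z (Equiv.swap i j k) ω := measurable_pi_lambda _ fun k => hZ _
  rw [← integral_map hm.aemeasurable hF.aestronglyMeasurable, ← h.map_swap hZ i j,
    integral_map hm'.aemeasurable hF.aestronglyMeasurable]

theorem integrable_of_measurable_of_abs_le {Ω : Type*} [MeasurableSpace Ω] {P : Measure Ω}
    [IsFiniteMeasure P] {f : Ω → ℝ} (hf : Measurable f) {C : ℝ} (h : ∀ᵐ ω ∂P, |f ω| ≤ C) :
    Integrable f P :=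
  Integrable.of_bound hf.aestronglyMeasurable C h

/-- The covariance structure of an exchangeable sequence with values in `[0, 1]`. -/
theorem Exchangeable.exists_integral_mul_eq {Ω X : Type*} [MeasurableSpace Ω] [MeasurableSpace X]
    {Z : ℕ → Ω → X} {P : Measure Ω} [IsProbabilityMeasure P] (h : Exchangeable Z P)
    (hZ : ∀ n, Measurable (Z n)) {f : X → ℝ} (hf : Measurable f) (h01 : ∀ x, f x ∈ Set.Icc 0 1) :
    ∃ c v : ℝ, 0 ≤ c ∧ v ≤ 1 ∧
      ∀ i j, ∫ ω, f (Z i ω) * f (Z j ω) ∂P = c + if i = j then v - c else 0 := by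
  have hs : ∀ a b i j, ∫ ω, f (Z (Equiv.swap a b i) ω) * f (Z (Equiv.swap a b j) ω) ∂P =
      ∫ ω, f (Z i ω) * f (Z j ω) ∂P := fun a b i j =>
    h.integral_comp_swap hZ a b (F := fun z => f (z i) * f (z j)) (by fun_prop)
  refine ⟨∫ ω, f (Z 0 ω) * f (Z 1 ω) ∂P, ∫ ω, f (Z 0 ω) * f (Z 0 ω) ∂P, ?_, ?_, fun i j => ?_⟩
  · exact integral_nonneg fun ω => mul_nonneg (h01 _).1 (h01 _).1
  · calc ∫ ω, f (Z 0 ω) * f (Z 0 ω) ∂P ≤ ∫ _, (1 : ℝ) ∂P := by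
          refine integral_mono (integrable_of_measurable_of_abs_le (C := 1) (by fun_prop)
            (Eventually.of_forall fun ω => ?_)) (integrable_const _) fun ω => ?_
          · rw [abs_of_nonneg (mul_nonneg (h01 _).1 (h01 _).1)]
            exact mul_le_one₀ (h01 _).2 (h01 _).1 (h01 _).2
          · exact mul_le_one₀ (h01 _).2 (h01 _).1 (h01 _).2
      _ = 1 := by simp
  · by_cases hij : i = j
    · subst hij
      rw [← hs i 0 i i]
      simp
    · rw [← hs i 0 i j, Equiv.swap_apply_left, ← hs (Equiv.swap i 0 j) 1, Equiv.swap_apply_left,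
        Equiv.swap_apply_of_ne_of_ne (a := Equiv.swap i 0 j) (x := 0)]
      · simp [hij]
      · intro h0
        apply hij
        rw [← Equiv.apply_eq_iff_eq (Equiv.swap i 0), ← h0, Equiv.swap_apply_left]
      · exact zero_ne_one

/-- If random weights with sum zero are independent of an exchangeable sequence with values in
`[0, 1]`, then the weighted sum is controlled in `L²` by the sum of the squared weights. -/
theorem Exchangeable.integral_sq_sum_le {Ω X : Type*} [MeasurableSpace Ω] [MeasurableSpace X]
    {Z : ℕ → Ω → X} {P : Measure Ω} [IsProbabilityMeasure P] (h : Exchangeable Z P)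
    (hZ : ∀ n, Measurable (Z n)) {f : X → ℝ} (hf : Measurable f) (h01 : ∀ x, f x ∈ Set.Icc 0 1)
    {n : ℕ} {a : Fin n → Ω → ℝ} (ha : ∀ i, Measurable (a i)) (ha1 : ∀ᵐ ω ∂P, ∀ i, |a i ω| ≤ 1)
    (hind : IndepFun (fun ω i => a i ω) (fun ω k => Z k ω) P)
    (hsum : ∀ᵐ ω ∂P, ∑ i, a i ω = 0) :
    ∫ ω, (∑ i, a i ω * f (Z i ω)) ^ 2 ∂P ≤ ∫ ω, ∑ i, a i ω ^ 2 ∂P := by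
  obtain ⟨c, v, hc, hv, hcv⟩ := h.exists_integral_mul_eq hZ hf h01
  have hia : ∀ i j, Integrable (fun ω => a i ω * a j ω) P := fun i j => by
    refine integrable_of_measurable_of_abs_le (C := 1) (by fun_prop) ?_
    filter_upwards [ha1] with ω hω
    rw [abs_mul]
    exact mul_le_one₀ (hω i) (abs_nonneg _) (hω j)
  have hif : ∀ i j : Fin n, Measurable fun ω => f (Z i ω) * f (Z j ω) := by fun_prop
  have hi4 : ∀ i j : Fin n, Integrable (fun ω => a i ω * a j ω * (f (Z i ω) * f (Z j ω))) P :=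
    fun i j => (hia i j).mul_bdd (c := 1) (hif i j).aestronglyMeasurable
      (Eventually.of_forall fun ω => by
        rw [Real.norm_of_nonneg (mul_nonneg (h01 _).1 (h01 _).1)]
        exact mul_le_one₀ (h01 _).2 (h01 _).1 (h01 _).2)
  have hmul : ∀ i j : Fin n, ∫ ω, a i ω * a j ω * (f (Z i ω) * f (Z j ω)) ∂P =
      (∫ ω, a i ω * a j ω ∂P) * (c + if i = j then v - c else 0) := fun i j => by
    have hI : IndepFun (fun ω => a i ω * a j ω) (fun ω => f (Z i ω) * f (Z j ω)) P :=
      hind.comp (φ := fun b : Fin n → ℝ => b i * b j)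
        (ψ := fun z : ℕ → X => f (z i) * f (z j))
        (by fun_prop) (by fun_prop)
    rw [hI.integral_fun_mul_eq_mul_integral (by fun_prop) (by fun_prop)]
    congr 1
    simp [hcv, Fin.ext_iff]
  -- The zero sum cancels the constant part `c` of the moments; only the diagonal excess `v - c ≤ 1`
  -- remains.
  have hzero : ∑ i, ∑ j, ∫ ω, a i ω * a j ω ∂P = 0 := by
    have : ∀ i, ∑ j, ∫ ω, a i ω * a j ω ∂P = 0 := fun i => by
      rw [← integral_finsetSum _ fun j _ => hia i j]
      refine integral_eq_zero_of_ae ?_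
      filter_upwards [hsum] with ω hω
      rw [← Finset.mul_sum, hω, mul_zero]
      rfl
    simp [this]
  have hlhs : ∫ ω, (∑ i, a i ω * f (Z i ω)) ^ 2 ∂P =
      (v - c) * ∫ ω, ∑ i, a i ω ^ 2 ∂P := by
    calc ∫ ω, (∑ i, a i ω * f (Z i ω)) ^ 2 ∂P
        = ∫ ω, ∑ i, ∑ j, a i ω * a j ω * (f (Z i ω) * f (Z j ω)) ∂P := by
          congr 1
          funext ω
          rw [sq, Finset.sum_mul_sum]
          exact Finset.sum_congr rfl fun i _ => Finset.sum_congr rfl fun j _ => by ring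
      _ = ∑ i, ∑ j, (∫ ω, a i ω * a j ω ∂P) * (c + if i = j then v - c else 0) := by
          rw [integral_finsetSum _ fun i _ => integrable_finsetSum _ fun j _ => hi4 i j]
          refine Finset.sum_congr rfl fun i _ => ?_
          rw [integral_finsetSum _ fun j _ => hi4 i j]
          exact Finset.sum_congr rfl fun j _ => hmul i j
      _ = (v - c) * ∫ ω, ∑ i, a i ω ^ 2 ∂P := by
          simp only [mul_add, Finset.sum_add_distrib, ← Finset.sum_mul, hzero, mul_ite, mul_zero,
            Finset.sum_ite_eq, Finset.mem_univ, if_true]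
          rw [integral_finsetSum _ fun i _ => by simpa only [sq] using hia i i]
          simp only [sq]
          ring
  rw [hlhs]
  have h0 : 0 ≤ ∫ ω, ∑ i, a i ω ^ 2 ∂P :=
    integral_nonneg fun ω => Finset.sum_nonneg fun i _ => sq_nonneg _
  nlinarith

/-! ### Almost sure convergence of averages along fourth powers -/

/-- A series of nonnegative integrable random variables with summable expectations converges
almost surely. -/
theorem ae_summable_of_summable_integral {Ω : Type*} [MeasurableSpace Ω] {P : Measure Ω}
    {f : ℕ → Ω → ℝ} (hf : ∀ j, Integrable (f j) P) (h0 : ∀ j, 0 ≤ᵐ[P] f j)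
    (hs : Summable fun j => ∫ ω, f j ω ∂P) : ∀ᵐ ω ∂P, Summable fun j => f j ω := by
  have hlt : ∫⁻ ω, ∑' j, ENNReal.ofReal (f j ω) ∂P < ⊤ := by
    rw [lintegral_tsum fun j => (hf j).aemeasurable.ennreal_ofReal]
    simp_rw [← ofReal_integral_eq_lintegral_ofReal (hf _) (h0 _)]
    exact hs.tsum_ofReal_lt_top
  have hm : AEMeasurable (fun ω => ∑' j, ENNReal.ofReal (f j ω)) P :=
    AEMeasurable.tsum fun j => (hf j).aemeasurable.ennreal_ofReal
  filter_upwards [ae_lt_top' hm hlt.ne, ae_all_iff.2 h0] with ω hω hω0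
  have := ENNReal.summable_toReal hω.ne
  refine this.congr fun j => ?_
  exact ENNReal.toReal_ofReal (hω0 j)

/-- The average of `f` over the first `n` terms of a sequence. -/
noncomputable def seqAverage {X : Type*} (f : X → ℝ) (n : ℕ) (z : ℕ → X) : ℝ :=
  (n : ℝ)⁻¹ * ∑ i ∈ Finset.range n, f (z i)

theorem measurable_seqAverage {X : Type*} [MeasurableSpace X] {f : X → ℝ} (hf : Measurable f)
    (n : ℕ) : Measurable (seqAverage f n) := by
  unfold seqAverage
  fun_prop

theorem seqAverage_mem_Icc {X : Type*} {f : X → ℝ} (h01 : ∀ x, f x ∈ Set.Icc 0 1) (n : ℕ)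
    (z : ℕ → X) : seqAverage f n z ∈ Set.Icc 0 1 := by
  refine ⟨mul_nonneg (by positivity) (Finset.sum_nonneg fun i _ => (h01 _).1), ?_⟩
  have h : ∑ i ∈ Finset.range n, f (z i) ≤ n := by
    simpa using Finset.sum_le_sum fun i (_ : i ∈ Finset.range n) => (h01 (z i)).2
  exact (mul_le_mul_of_nonneg_left h (by positivity)).trans (inv_mul_le_one)

theorem summable_one_div_add_one_sq : Summable fun j : ℕ => 1 / ((j : ℝ) + 1) ^ 2 := by
  have := (summable_nat_add_iff 1).2 (Real.summable_one_div_nat_pow.2 one_lt_two)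
  exact_mod_cast this

/-- The difference has deterministic weights `1/n - 1/m` for `i < m` and `1/n` beyond; they sum to
zero and their squares sum to `1/m - 1/n`. -/
theorem Exchangeable.integral_sq_seqAverage_sub_le {Ω X : Type*} [MeasurableSpace Ω]
    [MeasurableSpace X] {Z : ℕ → Ω → X} {P : Measure Ω} [IsProbabilityMeasure P]
    (h : Exchangeable Z P) (hZ : ∀ n, Measurable (Z n)) {f : X → ℝ} (hf : Measurable f)
    (h01 : ∀ x, f x ∈ Set.Icc 0 1) {m n : ℕ} (hm : 0 < m) (hmn : m ≤ n) :
    ∫ ω, (seqAverage f n (fun k => Z k ω) - seqAverage f m (fun k => Z k ω)) ^ 2 ∂P ≤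
      (m : ℝ)⁻¹ := by
  have hm' : (0 : ℝ) < m := by exact_mod_cast hm
  have hn' : (0 : ℝ) < n := by exact_mod_cast hm.trans_le hmn
  have hle : (n : ℝ)⁻¹ ≤ (m : ℝ)⁻¹ := inv_anti₀ hm' (by exact_mod_cast hmn)
  have hm1 : (m : ℝ)⁻¹ ≤ 1 := inv_le_one_of_one_le₀ (by exact_mod_cast hm)
  have hn0 : 0 < (n : ℝ)⁻¹ := by positivity
  set b : ℕ → ℝ := fun i => (n : ℝ)⁻¹ - if i < m then (m : ℝ)⁻¹ else 0 with hb
  have hsub : ∀ g : ℕ → ℝ, ∑ i : Fin n, (if (i : ℕ) < m then g i else 0) = ∑ i ∈ Finset.range m, g i := by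
    intro g
    rw [Fin.sum_univ_eq_sum_range (fun i => if i < m then g i else 0) n, ← Finset.sum_filter]
    refine Finset.sum_congr (Finset.ext fun i => ?_) fun _ _ => rfl
    simp only [Finset.mem_filter, Finset.mem_range]
    omega
  have key := h.integral_sq_sum_le hZ hf h01 (a := fun (i : Fin n) _ => b i)
    (fun _ => measurable_const) (Eventually.of_forall fun _ i => ?_) (indepFun_const_left _ _)
    (Eventually.of_forall fun _ => ?_)
  · refine le_trans (le_of_eq ?_) (key.trans ?_)
    · congr 1
      funext ω
      congr 1
      simp only [hb, sub_mul, ite_mul, zero_mul, Finset.sum_sub_distrib,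
        hsub (fun i => (m : ℝ)⁻¹ * f (Z i ω)), seqAverage, Finset.mul_sum]
      rw [Fin.sum_univ_eq_sum_range (fun i => (n : ℝ)⁻¹ * f (Z i ω)) n]
    · have : ∀ i : Fin n, b i ^ 2 = (n : ℝ)⁻¹ ^ 2 +
          if (i : ℕ) < m then (m : ℝ)⁻¹ ^ 2 - 2 * (n : ℝ)⁻¹ * (m : ℝ)⁻¹ else 0 := by
        intro i
        simp only [hb]
        split_ifs <;> ring
      simp only [this, Finset.sum_add_distrib, hsub (fun _ => (m : ℝ)⁻¹ ^ 2 - 2 * (n : ℝ)⁻¹ * (m : ℝ)⁻¹)]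
      simp only [Finset.sum_const, Finset.card_univ, Fintype.card_fin, Finset.card_range,
        nsmul_eq_mul, integral_const, probReal_univ, one_smul]
      have e1 : (n : ℝ) * (n : ℝ)⁻¹ ^ 2 = (n : ℝ)⁻¹ := by field_simp
      have e2 : (m : ℝ) * ((m : ℝ)⁻¹ ^ 2 - 2 * (n : ℝ)⁻¹ * (m : ℝ)⁻¹) = (m : ℝ)⁻¹ - 2 * (n : ℝ)⁻¹ := by
        field_simp
      rw [e1, e2]
      linarith
  · simp only [hb]
    rw [abs_le]
    split_ifs <;> constructor <;> linarith
  · simp only [hb, Finset.sum_sub_distrib, hsub (fun _ => (m : ℝ)⁻¹)]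
    simp [hn'.ne', hm'.ne']

theorem Exchangeable.ae_exists_tendsto_seqAverage {Ω X : Type*} [MeasurableSpace Ω]
    [MeasurableSpace X] {Z : ℕ → Ω → X} {P : Measure Ω} [IsProbabilityMeasure P]
    (h : Exchangeable Z P) (hZ : ∀ n, Measurable (Z n)) {f : X → ℝ} (hf : Measurable f)
    (h01 : ∀ x, f x ∈ Set.Icc 0 1) :
    ∀ᵐ ω ∂P, ∃ l, Tendsto (fun j : ℕ => seqAverage f ((j + 1) ^ 4) fun k => Z k ω) atTop (𝓝 l) := by
  set d : ℕ → Ω → ℝ := fun j ω => seqAverage f ((j + 1 + 1) ^ 4) (fun k => Z k ω) -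
    seqAverage f ((j + 1) ^ 4) (fun k => Z k ω) with hd
  have hdm : ∀ j, Measurable (d j) := fun j =>
    ((measurable_seqAverage hf _).comp (measurable_pi_lambda _ hZ)).sub
      ((measurable_seqAverage hf _).comp (measurable_pi_lambda _ hZ))
  have hd1 : ∀ j ω, |d j ω| ≤ 1 := fun j ω => by
    have h1 := seqAverage_mem_Icc h01 ((j + 1 + 1) ^ 4) (fun k => Z k ω)
    have h2 := seqAverage_mem_Icc h01 ((j + 1) ^ 4) (fun k => Z k ω)
    rw [abs_le]
    constructor <;> simp only [hd] <;> linarith [h1.1, h1.2, h2.1, h2.2]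
  -- Since E(d j)² ≤ (j + 1)⁻⁴, the factor `(j + 1) ^ 2` still leaves a summable series. It is what
  -- allows, by AM–GM, passing from squares to summability of `|d j|` itself.
  have hint : ∀ j : ℕ, Integrable (fun ω => ((j : ℝ) + 1) ^ 2 * d j ω ^ 2) P := fun j =>
    (integrable_of_measurable_of_abs_le (C := 1) ((hdm j).pow_const 2)
      (Eventually.of_forall fun ω => by
        rw [abs_pow]; exact pow_le_one₀ (abs_nonneg _) (hd1 j ω))).const_mul _
  have hle : ∀ j : ℕ, ∫ ω, ((j : ℝ) + 1) ^ 2 * d j ω ^ 2 ∂P ≤ 1 / ((j : ℝ) + 1) ^ 2 := fun j => by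
    have := h.integral_sq_seqAverage_sub_le hZ hf h01 (m := (j + 1) ^ 4) (n := (j + 1 + 1) ^ 4)
      (by positivity) (Nat.pow_le_pow_left (Nat.le_succ _) 4)
    rw [integral_const_mul]
    refine (mul_le_mul_of_nonneg_left this (by positivity)).trans (le_of_eq ?_)
    push_cast
    field_simp
  have hsum : Summable fun j : ℕ => ∫ ω, ((j : ℝ) + 1) ^ 2 * d j ω ^ 2 ∂P :=
    Summable.of_nonneg_of_le (fun j => integral_nonneg fun ω => by positivity) hle
      summable_one_div_add_one_sq
  filter_upwards [ae_summable_of_summable_integral hint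
    (fun j => Eventually.of_forall fun ω => by simp only [Pi.zero_apply]; positivity) hsum] with ω hω
  refine cauchySeq_tendsto_of_complete (cauchySeq_of_summable_dist ?_)
  refine Summable.of_nonneg_of_le (fun _ => dist_nonneg) (fun j => ?_)
    (hω.add summable_one_div_add_one_sq)
  rw [dist_comm, Real.dist_eq]
  change |d j ω| ≤ _
  have hj : (0 : ℝ) < (j : ℝ) + 1 := by positivity
  have e : ((j : ℝ) + 1) ^ 2 * d j ω ^ 2 + 1 / ((j : ℝ) + 1) ^ 2 =
      (((j : ℝ) + 1) * |d j ω| - 1 / ((j : ℝ) + 1)) ^ 2 + 2 * |d j ω| := by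
    rw [← sq_abs (d j ω)]
    field_simp
    ring
  rw [e]
  nlinarith [sq_nonneg (((j : ℝ) + 1) * |d j ω| - 1 / ((j : ℝ) + 1)), abs_nonneg (d j ω)]

/-! ### The tail σ-algebra and limits of averages -/

/-- The tail `σ`-algebra of a sequence of random variables. -/
@[reducible] def tailSigma {Ω X : Type*} [MeasurableSpace X] (Z : ℕ → Ω → X) : MeasurableSpace Ω :=
  ⨅ N : ℕ, MeasurableSpace.comap (fun ω k => Z (N + k) ω) MeasurableSpace.pi

theorem tailSigma_le {Ω X : Type*} [mΩ : MeasurableSpace Ω] [MeasurableSpace X] {Z : ℕ → Ω → X}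
    (hZ : ∀ n, Measurable (Z n)) : tailSigma Z ≤ mΩ :=
  (iInf_le _ 0).trans (measurable_iff_comap_le.1 (measurable_pi_lambda _ fun _ => hZ _))

/-- The limit, if it exists, of the averages of `f` along a sequence and a fixed sequence of
lengths. -/
noncomputable def limitAverage {X : Type*} (f : X → ℝ) (z : ℕ → X) : ℝ :=
  max 0 (min 1 (limUnder atTop fun j : ℕ => seqAverage f ((j + 1) ^ 4) z))

theorem measurable_limitAverage {X : Type*} [MeasurableSpace X] {f : X → ℝ} (hf : Measurable f) :
    Measurable (limitAverage f) := by
  have h : StronglyMeasurable fun z => limUnder atTop fun j : ℕ => seqAverage f ((j + 1) ^ 4) z :=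
    StronglyMeasurable.limUnder fun j => (measurable_seqAverage hf _).stronglyMeasurable
  exact measurable_const.max (measurable_const.min h.measurable)

/-- The truncation in the definition makes the bound valid even where the averages diverge. -/
theorem limitAverage_mem_Icc {X : Type*} (f : X → ℝ) (z : ℕ → X) :
    limitAverage f z ∈ Set.Icc 0 1 :=
  ⟨le_max_left _ _, max_le zero_le_one (min_le_left _ _)⟩

theorem tendsto_limitAverage {X : Type*} {f : X → ℝ} (h01 : ∀ x, f x ∈ Set.Icc 0 1) {z : ℕ → X}
    (h : ∃ l, Tendsto (fun j : ℕ => seqAverage f ((j + 1) ^ 4) z) atTop (𝓝 l)) :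
    Tendsto (fun j : ℕ => seqAverage f ((j + 1) ^ 4) z) atTop (𝓝 (limitAverage f z)) := by
  obtain ⟨l, hl⟩ := h
  have h1 : l ∈ Set.Icc (0 : ℝ) 1 :=
    isClosed_Icc.mem_of_tendsto hl (Eventually.of_forall fun j => seqAverage_mem_Icc h01 _ z)
  rwa [limitAverage, hl.limUnder_eq, min_eq_right h1.2, max_eq_right h1.1]

theorem tendsto_natCast_succ_pow_four :
    Tendsto (fun j : ℕ => (((j + 1) ^ 4 : ℕ) : ℝ)) atTop atTop :=
  tendsto_natCast_atTop_atTop.comp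
    ((tendsto_pow_atTop four_ne_zero).comp (tendsto_add_atTop_nat 1))

theorem tendsto_seqAverage_shift_sub {X : Type*} {f : X → ℝ} (h01 : ∀ x, f x ∈ Set.Icc 0 1)
    (z : ℕ → X) (N : ℕ) :
    Tendsto (fun j : ℕ => seqAverage f ((j + 1) ^ 4) (fun k => z (N + k)) -
      seqAverage f ((j + 1) ^ 4) z) atTop (𝓝 0) := by
  have h0 : Tendsto (fun j : ℕ => (((j + 1) ^ 4 : ℕ) : ℝ)⁻¹ * N) atTop (𝓝 0) := by
    simpa using tendsto_natCast_succ_pow_four.inv_tendsto_atTop.mul_const (N : ℝ)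
  refine squeeze_zero_norm (fun j => ?_) h0
  have hb : ∀ g : ℕ → X, ∑ i ∈ Finset.range N, f (g i) ∈ Set.Icc (0 : ℝ) N := fun g =>
    ⟨Finset.sum_nonneg fun i _ => (h01 _).1, by
      simpa using Finset.sum_le_sum fun i (_ : i ∈ Finset.range N) => (h01 (g i)).2⟩
  set n := (j + 1) ^ 4
  have e1 := Finset.sum_range_add (fun i => f (z i)) N n
  have e2 := Finset.sum_range_add (fun i => f (z i)) n N
  rw [add_comm N n] at e1
  have h1 := hb z
  have h2 := hb fun i => z (n + i)
  rw [Real.norm_eq_abs, seqAverage, seqAverage, ← mul_sub, abs_mul, abs_of_nonneg (by positivity)]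
  refine mul_le_mul_of_nonneg_left (abs_le.2 ⟨?_, ?_⟩) (by positivity) <;>
    linarith [h1.1, h1.2, h2.1, h2.2]

theorem tendsto_seqAverage_shift_iff {X : Type*} {f : X → ℝ} (h01 : ∀ x, f x ∈ Set.Icc 0 1)
    (z : ℕ → X) (N : ℕ) (l : ℝ) :
    Tendsto (fun j : ℕ => seqAverage f ((j + 1) ^ 4) fun k => z (N + k)) atTop (𝓝 l) ↔
      Tendsto (fun j : ℕ => seqAverage f ((j + 1) ^ 4) z) atTop (𝓝 l) := by
  have h := tendsto_seqAverage_shift_sub h01 z N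
  constructor
  · intro h'
    simpa using h'.sub h
  · intro h'
    simpa using h'.add h

/-- `limUnder` depends only on which points are limits, and a shift does not change these. Equality
thus holds at every sequence, convergent or not, which gives tail measurability without null sets.
-/
theorem limitAverage_shift {X : Type*} {f : X → ℝ} (h01 : ∀ x, f x ∈ Set.Icc 0 1)
    (z : ℕ → X) (N : ℕ) : limitAverage f (fun k => z (N + k)) = limitAverage f z := by
  have h : ∀ l, map (fun j : ℕ => seqAverage f ((j + 1) ^ 4) fun k => z (N + k)) atTop ≤ 𝓝 l ↔
      map (fun j : ℕ => seqAverage f ((j + 1) ^ 4) z) atTop ≤ 𝓝 l :=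
    tendsto_seqAverage_shift_iff h01 z N
  simp only [limitAverage, limUnder, lim, h]

theorem measurable_tailSigma_limitAverage {Ω X : Type*} [MeasurableSpace X] {Z : ℕ → Ω → X}
    {f : X → ℝ} (hf : Measurable f) (h01 : ∀ x, f x ∈ Set.Icc 0 1) :
    Measurable[tailSigma Z] fun ω => limitAverage f fun k => Z k ω := by
  rw [measurable_iff_comap_le, tailSigma, le_iInf_iff]
  intro N
  rw [← measurable_iff_comap_le]
  have e : (fun ω => limitAverage f fun k => Z k ω) =
      limitAverage f ∘ fun ω k => Z (N + k) ω := by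
    funext ω
    exact (limitAverage_shift h01 (fun k => Z k ω) N).symm
  rw [e]
  exact (measurable_limitAverage hf).comp (comap_measurable _)

/-! ### De Finetti's theorem -/

/-- Swapping `m` and `m + i` leaves the terms before `m` and those after `m + i` in place, and a
tail-measurable `H` is a function of the latter. -/
theorem Exchangeable.integral_mul_prod_mul_eq {Ω X : Type*} [MeasurableSpace Ω]
    [MeasurableSpace X] {Z : ℕ → Ω → X} {P : Measure Ω} [IsProbabilityMeasure P]
    (h : Exchangeable Z P) (hZ : ∀ n, Measurable (Z n)) {f : ℕ → X → ℝ}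
    (hf : ∀ l, Measurable (f l)) {H : Ω → ℝ} (hH : Measurable[tailSigma Z] H) (m i : ℕ) :
    ∫ ω, H ω * (∏ l ∈ Finset.range m, f l (Z l ω)) * f m (Z (m + i) ω) ∂P =
      ∫ ω, H ω * (∏ l ∈ Finset.range m, f l (Z l ω)) * f m (Z m ω) ∂P := by
  obtain ⟨g, hg, rfl⟩ := (hH.mono (iInf_le _ (m + i + 1)) le_rfl).exists_eq_measurable_comp
  have key := h.integral_comp_swap hZ m (m + i)
    (F := fun z => g (fun k => z (m + i + 1 + k)) * (∏ l ∈ Finset.range m, f l (z l)) * f m (z m))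
    (by
      have : Measurable fun z : ℕ → X => fun k => z (m + i + 1 + k) := by fun_prop
      have h2 := hg.comp this
      have h3 : ∀ l, Measurable fun z : ℕ → X => f l (z l) := fun l => by fun_prop
      exact (h2.mul (Finset.measurable_prod _ fun l _ => h3 l)).mul (h3 m))
  simp only [Equiv.swap_apply_left] at key
  simp only [Function.comp_apply]
  rw [← key]
  congr 1
  funext ω
  congr 2
  · congr 1
    funext k
    rw [Equiv.swap_apply_of_ne_of_ne (by omega) (by omega)]
  · refine Finset.prod_congr rfl fun l hl => ?_
    have := Finset.mem_range.1 hl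
    rw [Equiv.swap_apply_of_ne_of_ne (by omega) (by omega)]

/-- Averaging the preceding identity over `i` leaves its value unchanged, while the averages
converge boundedly to the limit average. -/
theorem Exchangeable.integral_mul_prod_mul_limitAverage {Ω X : Type*} [MeasurableSpace Ω]
    [MeasurableSpace X] {Z : ℕ → Ω → X} {P : Measure Ω} [IsProbabilityMeasure P]
    (h : Exchangeable Z P) (hZ : ∀ n, Measurable (Z n)) {f : ℕ → X → ℝ}
    (hf : ∀ l, Measurable (f l)) (h01 : ∀ l x, f l x ∈ Set.Icc 0 1) {H : Ω → ℝ}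
    (hH : Measurable[tailSigma Z] H) {C : ℝ} (hC : ∀ ω, |H ω| ≤ C) (m : ℕ) :
    ∫ ω, H ω * (∏ l ∈ Finset.range m, f l (Z l ω)) * f m (Z m ω) ∂P =
      ∫ ω, H ω * (∏ l ∈ Finset.range m, f l (Z l ω)) * limitAverage (f m) (fun k => Z k ω) ∂P := by
  have hHm : Measurable H := hH.mono (tailSigma_le hZ) le_rfl
  set G : Ω → ℝ := fun ω => H ω * ∏ l ∈ Finset.range m, f l (Z l ω)
  have hfm : ∀ l k, Measurable fun ω => f l (Z k ω) := fun l k => (hf l).comp (hZ k)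
  have hGm : Measurable G := hHm.mul (Finset.measurable_prod _ fun l _ => hfm l l)
  have hG : ∀ ω, |G ω| ≤ C := fun ω => by
    have h1 : ∏ l ∈ Finset.range m, f l (Z l ω) ≤ 1 :=
      Finset.prod_le_one (fun l _ => (h01 _ _).1) fun l _ => (h01 _ _).2
    have h0 : 0 ≤ ∏ l ∈ Finset.range m, f l (Z l ω) := Finset.prod_nonneg fun l _ => (h01 _ _).1
    rw [abs_mul, abs_of_nonneg h0]
    exact (mul_le_of_le_one_right (abs_nonneg _) h1).trans (hC ω)
  have hGf : ∀ (u : Ω → ℝ), (∀ ω, u ω ∈ Set.Icc (0 : ℝ) 1) → ∀ ω, |G ω * u ω| ≤ C := fun u hu ω => by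
    rw [abs_mul, abs_of_nonneg (hu ω).1]
    exact (mul_le_of_le_one_right (abs_nonneg _) (hu ω).2).trans (hG ω)
  have hmZ : ∀ N, Measurable fun ω k => Z (N + k) ω := fun N => measurable_pi_lambda _ fun k => hZ _
  have hconst : ∀ j : ℕ, ∫ ω, G ω * seqAverage (f m) ((j + 1) ^ 4) (fun k => Z (m + k) ω) ∂P =
      ∫ ω, G ω * f m (Z m ω) ∂P := fun j => by
    have hn : (((j + 1) ^ 4 : ℕ) : ℝ) ≠ 0 := by positivity
    have e : ∀ ω, G ω * seqAverage (f m) ((j + 1) ^ 4) (fun k => Z (m + k) ω) =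
        (((j + 1) ^ 4 : ℕ) : ℝ)⁻¹ * ∑ i ∈ Finset.range ((j + 1) ^ 4), G ω * f m (Z (m + i) ω) := by
      intro ω
      rw [seqAverage, ← Finset.mul_sum]
      ring
    simp_rw [e]
    rw [integral_const_mul, integral_finsetSum _ fun i _ =>
      integrable_of_measurable_of_abs_le (f := fun ω => G ω * f m (Z (m + i) ω))
        (hGm.mul (hfm m _)) (Eventually.of_forall (hGf (fun ω => f m (Z (m + i) ω)) fun ω => h01 _ _))]
    simp_rw [G, h.integral_mul_prod_mul_eq hZ hf hH]
    rw [Finset.sum_const, Finset.card_range, nsmul_eq_mul, inv_mul_cancel_left₀ hn]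
  have hlim : Tendsto (fun j : ℕ =>
      ∫ ω, G ω * seqAverage (f m) ((j + 1) ^ 4) (fun k => Z (m + k) ω) ∂P) atTop
      (𝓝 (∫ ω, G ω * limitAverage (f m) (fun k => Z k ω) ∂P)) := by
    refine tendsto_integral_of_dominated_convergence (fun _ => C) (fun j => ?_)
      (integrable_const _) (fun j => Eventually.of_forall ?_) ?_
    · exact (hGm.mul ((measurable_seqAverage (hf m) _).comp (hmZ m))).aestronglyMeasurable
    · exact hGf _ fun ω => seqAverage_mem_Icc (h01 m) _ _
    · filter_upwards [h.ae_exists_tendsto_seqAverage hZ (hf m) (h01 m)] with ω hω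
      exact ((tendsto_seqAverage_shift_iff (h01 m) (fun k => Z k ω) m _).2
        (tendsto_limitAverage (h01 m) hω)).const_mul _
  simp_rw [hconst] at hlim
  exact tendsto_nhds_unique tendsto_const_nhds hlim

/-- **De Finetti's theorem** for bounded functions: given the tail, the terms of an exchangeable
sequence are independent, and the limits of averages are their expectations. -/
theorem Exchangeable.integral_mul_prod_eq {Ω X : Type*} [MeasurableSpace Ω]
    [MeasurableSpace X] {Z : ℕ → Ω → X} {P : Measure Ω} [IsProbabilityMeasure P]
    (h : Exchangeable Z P) (hZ : ∀ n, Measurable (Z n)) {f : ℕ → X → ℝ}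
    (hf : ∀ l, Measurable (f l)) (h01 : ∀ l x, f l x ∈ Set.Icc 0 1) (m : ℕ) {H : Ω → ℝ}
    (hH : Measurable[tailSigma Z] H) {C : ℝ} (hC : ∀ ω, |H ω| ≤ C) :
    ∫ ω, H ω * ∏ l ∈ Finset.range m, f l (Z l ω) ∂P =
      ∫ ω, H ω * ∏ l ∈ Finset.range m, limitAverage (f l) (fun k => Z k ω) ∂P := by
  induction m generalizing H with
  | zero => simp
  | succ m ih =>
    simp_rw [Finset.prod_range_succ, ← mul_assoc]
    rw [h.integral_mul_prod_mul_limitAverage hZ hf h01 hH hC]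
    -- The new limit factor is tail measurable and bounded, so it is absorbed into `H`; this is why
    -- the induction is over all `H`.
    have hH' : Measurable[tailSigma Z] fun ω => H ω * limitAverage (f m) fun k => Z k ω :=
      hH.mul (measurable_tailSigma_limitAverage (hf m) (h01 m))
    have hC' : ∀ ω, |H ω * limitAverage (f m) fun k => Z k ω| ≤ C := fun ω => by
      have h1 := limitAverage_mem_Icc (f m) fun k => Z k ω
      rw [abs_mul, abs_of_nonneg h1.1]
      exact (mul_le_of_le_one_right (abs_nonneg _) h1.2).trans (hC ω)
    have := ih hH' hC'
    simp_rw [mul_right_comm _ (limitAverage (f m) _)] at this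
    exact this

/-- A regular conditional distribution, as a random probability measure. -/
theorem exists_measurable_probabilityMeasure_ae_eq_condExp {Ω X : Type*}
    {m : MeasurableSpace Ω} [mΩ : MeasurableSpace Ω] {P : Measure Ω} [IsProbabilityMeasure P]
    [Nonempty X] [MeasurableSpace X] [StandardBorelSpace X] (hm : m ≤ mΩ) {Y : Ω → X} (hY : Measurable Y) :
    ∃ κ : Ω → ProbabilityMeasure X, Measurable κ ∧ ∀ A, MeasurableSet A →
      (fun ω => (κ ω : Measure X).real A) =ᵐ[P] P⟦Y ⁻¹' A | m⟧ := by
  -- Conditioning on `m` is conditioning on the identity map into `Ω` equipped with `m`.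
  have hid : @Measurable Ω Ω mΩ m id := measurable_id.mono hm le_rfl
  refine ⟨fun ω => ⟨@condDistrib Ω Ω X _ _ _ mΩ m Y id P _ ω, inferInstance⟩, ?_, fun A hA => ?_⟩
  · exact (((@condDistrib Ω Ω X _ _ _ mΩ m Y id P _).measurable).mono hm le_rfl).subtype_mk
  · have := condDistrib_ae_eq_condExp (mβ := m) (μ := P) hid hY hA
    rwa [MeasurableSpace.comap_id] at this

theorem indicator_one_mem_Icc {X : Type*} (A : Set X) (x : X) :
    A.indicator (fun _ => (1 : ℝ)) x ∈ Set.Icc 0 1 :=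
  ⟨Set.indicator_nonneg (fun _ _ => zero_le_one) x, Set.indicator_le_self' (fun _ _ => zero_le_one) x⟩

/-- With one factor and `H` the indicator of a tail event, `Exchangeable.integral_mul_prod_eq` is
the defining property of the conditional expectation. -/
theorem Exchangeable.limitAverage_ae_eq_condExp {Ω X : Type*} [mΩ : MeasurableSpace Ω]
    [MeasurableSpace X] {Z : ℕ → Ω → X} {P : Measure Ω} [IsProbabilityMeasure P]
    (h : Exchangeable Z P) (hZ : ∀ n, Measurable (Z n)) {A : Set X} (hA : MeasurableSet A) :
    (fun ω => limitAverage (A.indicator fun _ => 1) fun k => Z k ω) =ᵐ[P]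
      P⟦Z 0 ⁻¹' A | tailSigma Z⟧ := by
  have hf : Measurable (A.indicator fun _ => (1 : ℝ)) := measurable_const.indicator hA
  have hL := measurable_tailSigma_limitAverage (Z := Z) hf (indicator_one_mem_Icc A)
  refine ae_eq_condExp_of_forall_setIntegral_eq (tailSigma_le hZ)
    ((integrable_const _).indicator (hZ 0 hA)) (fun s _ _ => ?_) (fun s hs _ => ?_)
    hL.aestronglyMeasurable
  · refine Integrable.integrableOn (integrable_of_measurable_of_abs_le (C := 1)
      (hL.mono (tailSigma_le hZ) le_rfl) (Eventually.of_forall fun ω => ?_))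
    have := limitAverage_mem_Icc (A.indicator fun _ => (1 : ℝ)) fun k => Z k ω
    rw [abs_of_nonneg this.1]
    exact this.2
  · have := h.integral_mul_prod_eq hZ (f := fun _ => A.indicator fun _ => (1 : ℝ)) (fun _ => hf)
      (fun _ => indicator_one_mem_Icc A) 1 (H := s.indicator fun _ => 1) (C := 1)
      (measurable_const.indicator hs) (fun ω => by
        rw [abs_of_nonneg (indicator_one_mem_Icc s ω).1]
        exact (indicator_one_mem_Icc s ω).2)
    simp only [Finset.prod_range_one] at this
    rw [← integral_indicator (tailSigma_le hZ s hs), ← integral_indicator (tailSigma_le hZ s hs)]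
    refine Eq.trans ?_ (this.symm.trans ?_) <;> congr 1 <;> funext ω <;> by_cases hω : ω ∈ s <;>
      simp [hω, Set.indicator]
    rfl

/-- **De Finetti's theorem**: existence of a random probability measure that directs an
exchangeable sequence, and its description through limits of averages. -/
theorem Exchangeable.exists_directing {Ω X : Type*} [MeasurableSpace Ω]
    [MeasurableSpace X] [StandardBorelSpace X] {Z : ℕ → Ω → X} {P : Measure Ω}
    [IsProbabilityMeasure P] (h : Exchangeable Z P) (hZ : ∀ n, Measurable (Z n)) :
    ∃ κ : Ω → ProbabilityMeasure X, Measurable κ ∧ IsDeFinettiMeasure (P.map κ) Z P ∧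
      ∀ A, MeasurableSet A → ∀ᵐ ω ∂P, Tendsto
        (fun j : ℕ => seqAverage (A.indicator fun _ => 1) ((j + 1) ^ 4) fun k => Z k ω) atTop
        (𝓝 ((κ ω : Measure X).real A)) := by
  have : Nonempty Ω := nonempty_of_isProbabilityMeasure P
  have : Nonempty X := ⟨Z 0 (Classical.arbitrary Ω)⟩
  obtain ⟨κ, hκ, hκA⟩ := exists_measurable_probabilityMeasure_ae_eq_condExp (P := P)
    (tailSigma_le hZ) (hZ 0)
  have hfm : ∀ A : Set X, MeasurableSet A → Measurable (A.indicator fun _ => (1 : ℝ)) :=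
    fun A hA => measurable_const.indicator hA
  have hκL : ∀ A, MeasurableSet A → ∀ᵐ ω ∂P,
      limitAverage (A.indicator fun _ => 1) (fun k => Z k ω) = (κ ω : Measure X).real A :=
    fun A hA => (h.limitAverage_ae_eq_condExp hZ hA).trans (hκA A hA).symm
  refine ⟨κ, hκ, ⟨Measure.isProbabilityMeasure_map hκ.aemeasurable, fun n A hA => ?_⟩,
    fun A hA => ?_⟩
  · have hκm : ∀ s, MeasurableSet s → Measurable fun ω => (κ ω : Measure X) s := fun s hs =>
      (Measure.measurable_coe hs).comp (measurable_subtype_coe.comp hκ)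
    have hev : ∀ s, MeasurableSet s → Measurable fun μ : ProbabilityMeasure X => (μ : Measure X) s :=
      fun s hs => (Measure.measurable_coe hs).comp measurable_subtype_coe
    rw [lintegral_map (Finset.measurable_prod _ fun i _ => hev _ (hA i)) hκ]
    set B : ℕ → Set X := fun l => if hl : l < n then A ⟨l, hl⟩ else Set.univ with hB
    have hBA : ∀ i : Fin n, B i = A i := fun i => by simp [hB]
    have hBm : ∀ l, MeasurableSet (B l) := fun l => by
      simp only [hB]
      split_ifs
      exacts [hA _, MeasurableSet.univ]
    have key := h.integral_mul_prod_eq hZ (f := fun l => (B l).indicator fun _ => (1 : ℝ))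
      (fun l => hfm _ (hBm l)) (fun l => indicator_one_mem_Icc (B l)) n (H := fun _ => 1) (C := 1)
      measurable_const (fun _ => by simp)
    simp only [one_mul] at key
    have hset : MeasurableSet {ω | ∀ i : Fin n, Z i ω ∈ A i} := by
      rw [Set.ofPred_forall]
      exact MeasurableSet.iInter fun i => hZ i (hA i)
    have hl : ∫ ω, ∏ l ∈ Finset.range n, (B l).indicator (fun _ => (1 : ℝ)) (Z l ω) ∂P =
        P.real {ω | ∀ i : Fin n, Z i ω ∈ A i} := by
      rw [← integral_indicator_one hset]
      congr 1
      funext ω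
      rw [← Fin.prod_univ_eq_prod_range (fun l => (B l).indicator (fun _ => (1 : ℝ)) (Z l ω))]
      by_cases hω : ∀ i : Fin n, Z i ω ∈ A i
      · rw [Set.indicator_of_mem (by exact hω)]
        exact Finset.prod_eq_one fun i _ => by rw [hBA, Set.indicator_of_mem (hω i)]
      · rw [Set.indicator_of_notMem (by exact hω)]
        push Not at hω
        obtain ⟨i, hi⟩ := hω
        exact Finset.prod_eq_zero (Finset.mem_univ i) (by rw [hBA, Set.indicator_of_notMem hi])
    have hr : ∫ ω, ∏ l ∈ Finset.range n, limitAverage ((B l).indicator fun _ => 1)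
        (fun k => Z k ω) ∂P = ∫ ω, ∏ i : Fin n, (κ ω : Measure X).real (A i) ∂P := by
      refine integral_congr_ae ?_
      filter_upwards [ae_all_iff.2 fun l => hκL (B l) (hBm l)] with ω hω
      rw [← Fin.prod_univ_eq_prod_range
        (fun l => limitAverage ((B l).indicator fun _ => (1 : ℝ)) fun k => Z k ω)]
      exact Finset.prod_congr rfl fun i _ => by rw [hω, hBA]
    rw [hl, hr] at key
    have hfin : ∀ ω, ∏ i : Fin n, (κ ω : Measure X) (A i) ≠ ⊤ := fun ω =>
      ENNReal.prod_ne_top fun i _ => measure_ne_top _ _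
    have hle : ∀ ω, ∏ i : Fin n, (κ ω : Measure X) (A i) ≤ 1 := fun ω =>
      Finset.prod_le_one' fun i _ => prob_le_one
    rw [← ENNReal.toReal_eq_toReal_iff' (measure_ne_top _ _)]
    · rw [← integral_toReal (Finset.measurable_prod _ fun i _ => hκm _ (hA i)).aemeasurable
        (Eventually.of_forall fun ω => (hfin ω).lt_top)]
      simpa [ENNReal.toReal_prod, Measure.real] using key
    · refine ne_of_lt (lt_of_le_of_lt (lintegral_mono hle) ?_)
      simp
  · filter_upwards [h.ae_exists_tendsto_seqAverage hZ (hfm A hA) (indicator_one_mem_Icc A),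
      hκL A hA] with ω hω hω'
    rw [← hω']
    exact tendsto_limitAverage (indicator_one_mem_Icc A) hω

/-! ### Weak convergence from countably many sets -/

/-- An open set is a directed union of such finite unions, so one of them has mass above any `c < μ
G` and bounds the lower limit on `G`; the portmanteau theorem concludes. -/
theorem tendsto_probabilityMeasure_of_tendsto_real_biUnion {X : Type*} [TopologicalSpace X]
    [TopologicalSpace.PseudoMetrizableSpace X] [SecondCountableTopology X] [MeasurableSpace X]
    [BorelSpace X] {μs : ℕ → ProbabilityMeasure X} {μ : ProbabilityMeasure X}
    (h : ∀ s : Finset (TopologicalSpace.countableBasis X),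
      Tendsto (fun n => (μs n : Measure X).real (⋃ i ∈ s, (i : Set X))) atTop
        (𝓝 ((μ : Measure X).real (⋃ i ∈ s, (i : Set X))))) :
    Tendsto μs atTop (𝓝 μ) := by
  let : PseudoMetricSpace X := TopologicalSpace.pseudoMetrizableSpacePseudoMetric X
  refine tendsto_of_forall_isOpen_le_liminf' (μ := μ) fun G hG => le_of_forall_lt fun c hc => ?_
  obtain ⟨T, hTB, hGT⟩ := (TopologicalSpace.isBasis_countableBasis X).open_eq_sUnion hG
  have : Countable T := ((TopologicalSpace.countable_countableBasis X).mono hTB).to_subtype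
  have hdir : Directed (· ⊆ ·) (fun s : Finset T => ⋃ i ∈ s, (i : Set X)) := by
    classical
    intro s t
    exact ⟨s ∪ t, Set.biUnion_subset_biUnion_left fun x hx => Finset.mem_union_left _ hx,
      Set.biUnion_subset_biUnion_left fun x hx => Finset.mem_union_right _ hx⟩
  have hU : G = ⋃ s : Finset T, ⋃ i ∈ s, (i : Set X) := by
    rw [hGT]
    ext x
    simp only [Set.mem_sUnion, Set.mem_iUnion]
    constructor
    · rintro ⟨t, ht, hx⟩
      exact ⟨{⟨t, ht⟩}, ⟨t, ht⟩, by simp, hx⟩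
    · rintro ⟨s, i, -, hx⟩
      exact ⟨i, i.2, hx⟩
  have hc' := hc
  rw [hU, hdir.measure_iUnion, lt_iSup_iff] at hc'
  obtain ⟨s, hs⟩ := hc'
  have hsub : (⋃ i ∈ s, (i : Set X)) ⊆ G := by
    rw [hU]
    exact Set.subset_iUnion (fun s : Finset T => ⋃ i ∈ s, (i : Set X)) s
  have hmap : (⋃ i ∈ s.map (Set.embeddingOfSubset _ _ hTB), (i : Set X)) = ⋃ i ∈ s, (i : Set X) := by
    ext x
    simp only [Set.mem_iUnion, Finset.mem_map, exists_prop]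
    constructor
    · rintro ⟨_, ⟨i, hi, rfl⟩, hx⟩
      exact ⟨i, hi, hx⟩
    · rintro ⟨i, hi, hx⟩
      exact ⟨_, ⟨i, hi, rfl⟩, hx⟩
  have hs' := h (s.map (Set.embeddingOfSubset _ _ hTB))
  rw [hmap] at hs'
  have hs'' : Tendsto (fun n => (μs n : Measure X) (⋃ i ∈ s, (i : Set X))) atTop
      (𝓝 ((μ : Measure X) (⋃ i ∈ s, (i : Set X)))) := by
    simpa using ENNReal.tendsto_ofReal hs'
  refine lt_of_lt_of_le (hs''.liminf_eq.symm ▸ hs) ?_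
  exact liminf_le_liminf (Eventually.of_forall fun n => measure_mono hsub)

/-! ### Convergence of the weighted averages -/

theorem exists_between_pow_four (J n : ℕ) (hn : (J + 1) ^ 4 ≤ n) :
    ∃ j, J ≤ j ∧ (j + 1) ^ 4 ≤ n ∧ n ≤ (j + 1 + 1) ^ 4 := by
  induction n, hn using Nat.le_induction with
  | base => exact ⟨J, le_rfl, le_rfl, Nat.pow_le_pow_left (Nat.le_succ _) 4⟩
  | succ n hn ih =>
    obtain ⟨j, hJ, h1, h2⟩ := ih
    by_cases h : n + 1 ≤ (j + 1 + 1) ^ 4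
    · exact ⟨j, hJ, h1.trans (Nat.le_succ _), h⟩
    · have h3 : (j + 1 + 1) ^ 4 < (j + 1 + 1 + 1) ^ 4 :=
        Nat.pow_lt_pow_left (Nat.lt_succ_self _) four_ne_zero
      exact ⟨j + 1, by omega, by omega, by omega⟩

theorem tendsto_of_tendsto_pow_four {u b : ℕ → ℝ} {l : ℝ}
    (hu : Tendsto (fun j => u ((j + 1) ^ 4)) atTop (𝓝 l)) (hb : Tendsto b atTop (𝓝 0))
    (h : ∀ j n, (j + 1) ^ 4 ≤ n → n ≤ (j + 1 + 1) ^ 4 → |u n - u ((j + 1) ^ 4)| ≤ b j) :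
    Tendsto u atTop (𝓝 l) := by
  rw [Metric.tendsto_atTop] at hu hb ⊢
  intro ε hε
  obtain ⟨J₁, h₁⟩ := hu (ε / 2) (half_pos hε)
  obtain ⟨J₂, h₂⟩ := hb (ε / 2) (half_pos hε)
  refine ⟨(max J₁ J₂ + 1) ^ 4, fun n hn => ?_⟩
  obtain ⟨j, hj, hj1, hj2⟩ := exists_between_pow_four _ n hn
  have e1 := h₁ j (le_of_max_le_left hj)
  have e2 := h₂ j (le_of_max_le_right hj)
  have e3 := h j n hj1 hj2
  rw [Real.dist_eq] at e1 e2 ⊢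
  rw [sub_zero] at e2
  calc |u n - l| ≤ |u n - u ((j + 1) ^ 4)| + |u ((j + 1) ^ 4) - l| := abs_sub_le _ _ _
    _ < ε := by linarith [le_abs_self (b j)]

/-- The `mixingWeights`-weighted sum of `f` along a sequence. -/
noncomputable def mixingAverage {X : Type*} (f : X → ℝ) (w : ℕ → ℝ) (z : ℕ → X) (n : ℕ) : ℝ :=
  ∑ i : Fin n, mixingWeights w n i * f (z i)

theorem mixingAverage_succ {X : Type*} (f : X → ℝ) (w : ℕ → ℝ) (z : ℕ → X) (n : ℕ) :
    mixingAverage f w z (n + 1) = (1 - w n) * mixingAverage f w z n + w n * f (z n) := by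
  simp [mixingAverage, mixingWeights_succ, Fin.sum_univ_castSucc, Finset.mul_sum, mul_assoc]

theorem mixingAverage_mem_Icc {X : Type*} {f : X → ℝ} (h01 : ∀ x, f x ∈ Set.Icc 0 1)
    {w : ℕ → ℝ} (hw : ∀ k, 0 ≤ w k ∧ w k ≤ 1) (z : ℕ → X) (n : ℕ) :
    mixingAverage f w z n ∈ Set.Icc 0 1 := by
  induction n with
  | zero => simp [mixingAverage]
  | succ n ih =>
    rw [mixingAverage_succ]
    exact (convex_Icc (0 : ℝ) 1) ih (h01 (z n)) (sub_nonneg.2 (hw n).2) (hw n).1 (by ring)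

/-- Step `k` moves the average by `w k` times a difference of two numbers in [0, 1]. -/
theorem abs_mixingAverage_sub_le {X : Type*} {f : X → ℝ} (h01 : ∀ x, f x ∈ Set.Icc 0 1)
    {w : ℕ → ℝ} (hw : ∀ k, 0 ≤ w k ∧ w k ≤ 1) (z : ℕ → X) {m n : ℕ} (hmn : m ≤ n) :
    |mixingAverage f w z n - mixingAverage f w z m| ≤ ∑ k ∈ Finset.Ico m n, w k := by
  induction n, hmn using Nat.le_induction with
  | base => simp
  | succ n hn ih =>
    have h1 := mixingAverage_mem_Icc h01 hw z n
    have h2 := h01 (z n)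
    have e : mixingAverage f w z (n + 1) - mixingAverage f w z n =
        w n * (f (z n) - mixingAverage f w z n) := by
      rw [mixingAverage_succ]; ring
    have h3 : |mixingAverage f w z (n + 1) - mixingAverage f w z n| ≤ w n := by
      rw [e, abs_mul, abs_of_nonneg (hw n).1]
      refine mul_le_of_le_one_right (hw n).1 (abs_le.2 ⟨?_, ?_⟩) <;>
        linarith [h1.1, h1.2, h2.1, h2.2]
    rw [Finset.sum_Ico_succ_top hn]
    linarith [abs_sub_le (mixingAverage f w z (n + 1)) (mixingAverage f w z n)
      (mixingAverage f w z m)]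

section Beta

variable {Ω : Type*} [MeasurableSpace Ω] {P : Measure Ω} {W : ℕ → Ω → ℝ}

theorem ae_forall_mem_Icc_of_hasLaw_beta (hW_one : ∀ᵐ ω ∂P, W 0 ω = 1)
    (hW_beta : ∀ n : ℕ, 1 ≤ n → HasLaw (W n) (betaMeasure 1 n) P) :
    ∀ᵐ ω ∂P, ∀ k, 0 ≤ W k ω ∧ W k ω ≤ 1 := by
  refine ae_all_iff.2 fun k => ?_
  rcases Nat.eq_zero_or_pos k with rfl | hk
  · filter_upwards [hW_one] with ω hω
    simp [hω]
  · have h := hW_beta k hk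
    filter_upwards [ae_of_ae_map h.aemeasurable (h.map_eq ▸ ae_mem_Ioo_betaMeasure 1 k)] with ω hω
    exact ⟨hω.1.le, hω.2.le⟩

theorem integral_sq_of_hasLaw_beta {V : Ω → ℝ} {n : ℕ} (hn : 1 ≤ n)
    (h : HasLaw V (betaMeasure 1 n) P) :
    ∫ ω, V ω ^ 2 ∂P = 2 / ((n + 1) * (n + 2)) := by
  rw [← integral_sq_betaMeasure_one hn, ← h.integral_comp (f := fun x => x ^ 2) (by fun_prop)]
  rfl

theorem integral_one_sub_sq_of_hasLaw_beta {V : Ω → ℝ} {n : ℕ} (hn : 1 ≤ n)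
    (h : HasLaw V (betaMeasure 1 n) P) :
    ∫ ω, (1 - V ω) ^ 2 ∂P = (n : ℝ) / (n + 2) := by
  rw [← integral_one_sub_sq_betaMeasure_one hn,
    ← h.integral_comp (f := fun x => (1 - x) ^ 2) (by fun_prop)]
  rfl

variable [IsProbabilityMeasure P]

theorem abs_mixingWeights_le_one {w : ℕ → ℝ} (h : ∀ k, 0 ≤ w k ∧ w k ≤ 1) (n : ℕ) (i : Fin n) :
    |mixingWeights w n i| ≤ 1 := by
  rw [abs_of_nonneg (mixingWeights_nonneg h n i)]
  exact mul_le_one₀ (h i).2 (Finset.prod_nonneg fun j _ => sub_nonneg.2 (h j).2)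
    (Finset.prod_le_one (fun j _ => sub_nonneg.2 (h j).2) fun j _ => by linarith [(h j).1])

theorem integrable_sum_sq_mixingWeights (hW : ∀ n, Measurable (W n))
    (h01 : ∀ᵐ ω ∂P, ∀ k, 0 ≤ W k ω ∧ W k ω ≤ 1) (n : ℕ) :
    Integrable (fun ω => ∑ i, mixingWeights (fun k => W k ω) n i ^ 2) P := by
  have hm : Measurable fun ω => mixingWeights (fun k => W k ω) n :=
    (measurable_mixingWeights n).comp (measurable_pi_lambda _ hW)
  refine integrable_finsetSum _ fun i _ =>
    integrable_of_measurable_of_abs_le (C := 1) (((measurable_pi_apply i).comp hm).pow_const 2) ?_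
  filter_upwards [h01] with ω hω
  rw [abs_pow]
  exact pow_le_one₀ (abs_nonneg _) (abs_mixingWeights_le_one hω n i)

/-- By independence the expectations satisfy s(n+1) = n/(n+2) · s(n) + 2/((n+1)(n+2)) with s(1) = 1.
-/
theorem integral_sum_sq_mixingWeights (hW : ∀ n, Measurable (W n)) (hW_indep : iIndepFun W P)
    (hW_one : ∀ᵐ ω ∂P, W 0 ω = 1)
    (hW_beta : ∀ n : ℕ, 1 ≤ n → HasLaw (W n) (betaMeasure 1 n) P) {n : ℕ} (hn : 1 ≤ n) :
    ∫ ω, ∑ i, mixingWeights (fun k => W k ω) n i ^ 2 ∂P = 2 / (n + 1) := by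
  have h01 := ae_forall_mem_Icc_of_hasLaw_beta hW_one hW_beta
  induction n, hn using Nat.le_induction with
  | base =>
    have : ∀ᵐ ω ∂P, ∑ i, mixingWeights (fun k => W k ω) 1 i ^ 2 = 1 := by
      filter_upwards [hW_one] with ω hω
      simp [mixingWeights_one, hω]
    rw [integral_congr_ae this]
    norm_num
  | succ n hn ih =>
    have hI := (indepFun_mixingWeights hW hW_indep n).symm.comp
      (φ := fun x : ℝ => (1 - x) ^ 2) (ψ := fun v : Fin n → ℝ => ∑ i, v i ^ 2)
      (by fun_prop) (by fun_prop)
    have hmul := hI.integral_fun_mul_eq_mul_integral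
      (by fun_prop) (integrable_sum_sq_mixingWeights hW h01 n).aestronglyMeasurable
    simp only [Function.comp_apply] at hmul
    have hint1 : Integrable (fun ω => (1 - W n ω) ^ 2) P := by
      refine integrable_of_measurable_of_abs_le (C := 1) (by fun_prop) ?_
      filter_upwards [h01] with ω hω
      rw [abs_pow]
      exact pow_le_one₀ (abs_nonneg _) (abs_le.2 ⟨by linarith [(hω n).2], by linarith [(hω n).1]⟩)
    have hint2 : Integrable (fun ω => W n ω ^ 2) P := by
      refine integrable_of_measurable_of_abs_le (C := 1) (by fun_prop) ?_
      filter_upwards [h01] with ω hω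
      rw [abs_pow]
      exact pow_le_one₀ (abs_nonneg _) (abs_le.2 ⟨by linarith [(hω n).1], (hω n).2⟩)
    simp_rw [sum_sq_mixingWeights_succ]
    have hprod : Integrable
        (fun ω => (1 - W n ω) ^ 2 * ∑ i, mixingWeights (fun k => W k ω) n i ^ 2) P :=
      hI.integrable_mul hint1 (integrable_sum_sq_mixingWeights hW h01 n)
    rw [integral_add hprod hint2,
      hmul, ih, integral_sq_of_hasLaw_beta hn (hW_beta n hn),
      integral_one_sub_sq_of_hasLaw_beta hn (hW_beta n hn)]
    push_cast
    field_simp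
    ring

/-- By Cauchy–Schwarz the squared block sum is at most the block length times the sum of squares,
and the expectations of these bounds are summable. -/
theorem ae_tendsto_sum_Ico_of_hasLaw_beta (hW : ∀ n, Measurable (W n))
    (hW_one : ∀ᵐ ω ∂P, W 0 ω = 1)
    (hW_beta : ∀ n : ℕ, 1 ≤ n → HasLaw (W n) (betaMeasure 1 n) P) :
    ∀ᵐ ω ∂P, Tendsto (fun j : ℕ => ∑ k ∈ Finset.Ico ((j + 1) ^ 4) ((j + 1 + 1) ^ 4), W k ω)
      atTop (𝓝 0) := by
  have h01 := ae_forall_mem_Icc_of_hasLaw_beta hW_one hW_beta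
  have hint2 : ∀ n, Integrable (fun ω => W n ω ^ 2) P := fun n => by
    refine integrable_of_measurable_of_abs_le (C := 1) (by fun_prop) ?_
    filter_upwards [h01] with ω hω
    rw [abs_pow]
    exact pow_le_one₀ (abs_nonneg _) (abs_le.2 ⟨by linarith [(hω n).1], (hω n).2⟩)
  set S : ℕ → Finset ℕ := fun j => Finset.Ico ((j + 1) ^ 4) ((j + 1 + 1) ^ 4) with hS
  set b : ℕ → Ω → ℝ := fun j ω => ((S j).card : ℝ) * ∑ k ∈ S j, W k ω ^ 2 with hb
  have hbint : ∀ j, Integrable (b j) P := fun j =>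
    (integrable_finsetSum _ fun k _ => hint2 k).const_mul _
  have hb0 : ∀ j ω, 0 ≤ b j ω := fun j ω =>
    mul_nonneg (Nat.cast_nonneg _) (Finset.sum_nonneg fun _ _ => sq_nonneg _)
  -- With x = j + 1 ≥ 1, (x + 1)⁴ - x⁴ = 4x³ + 6x² + 4x + 1 ≤ 15x³. Below, 450 = 15² · 2.
  have hcard : ∀ j, ((S j).card : ℝ) ≤ 15 * ((j : ℝ) + 1) ^ 3 := fun j => by
    rw [hS, Nat.card_Ico, Nat.cast_sub (Nat.pow_le_pow_left (Nat.le_succ _) 4)]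
    push_cast
    have : (0 : ℝ) ≤ j := Nat.cast_nonneg j
    nlinarith [pow_nonneg this 2, pow_nonneg this 3]
  have hle : ∀ j : ℕ, ∫ ω, b j ω ∂P ≤ 450 * (1 / ((j : ℝ) + 1) ^ 2) := fun j => by
    have hj : (0 : ℝ) < (j : ℝ) + 1 := by positivity
    have hk : ∀ k ∈ S j, ∫ ω, W k ω ^ 2 ∂P ≤ 2 / (((j : ℝ) + 1) ^ 4) ^ 2 := fun k hk => by
      have h1 := (Finset.mem_Ico.1 hk).1
      have h2 : 1 ≤ k := (Nat.one_le_pow _ _ (Nat.succ_pos j)).trans h1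
      have h3 : ((j : ℝ) + 1) ^ 4 ≤ k := by exact_mod_cast h1
      have h4 : (0 : ℝ) < ((j : ℝ) + 1) ^ 4 := by positivity
      rw [integral_sq_of_hasLaw_beta h2 (hW_beta k h2)]
      refine div_le_div_of_nonneg_left zero_le_two (by positivity) ?_
      nlinarith
    rw [hb, integral_const_mul, integral_finsetSum _ fun k _ => hint2 k]
    calc ((S j).card : ℝ) * ∑ k ∈ S j, ∫ ω, W k ω ^ 2 ∂P
        ≤ (S j).card * ((S j).card * (2 / (((j : ℝ) + 1) ^ 4) ^ 2)) := by
          refine mul_le_mul_of_nonneg_left ?_ (Nat.cast_nonneg _)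
          simpa using Finset.sum_le_sum hk
      _ ≤ (15 * ((j : ℝ) + 1) ^ 3) * ((15 * ((j : ℝ) + 1) ^ 3) * (2 / (((j : ℝ) + 1) ^ 4) ^ 2)) := by
          have := hcard j
          gcongr
      _ = 450 * (1 / ((j : ℝ) + 1) ^ 2) := by
          field_simp
          norm_num
  have hsum : Summable fun j : ℕ => ∫ ω, b j ω ∂P :=
    Summable.of_nonneg_of_le (fun j => integral_nonneg (hb0 j)) hle
      (summable_one_div_add_one_sq.mul_left 450)
  filter_upwards [ae_summable_of_summable_integral hbint
    (fun j => Eventually.of_forall (hb0 j)) hsum] with ω hω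
  have h0 := (Real.continuous_sqrt.tendsto 0).comp hω.tendsto_atTop_zero
  rw [Real.sqrt_zero] at h0
  exact squeeze_zero_norm (fun j => Real.abs_le_sqrt sq_sum_le_card_mul_sum_sq) h0

variable {X : Type*} [MeasurableSpace X] {Z : ℕ → Ω → X}

/-- The weights minus `1/n` sum to zero and are independent of `Z`; their squares have expected sum
`2/(n+1) - 1/n ≤ 1/n`. -/
theorem integral_sq_mixingAverage_sub_le (hW : ∀ n, Measurable (W n))
    (hZ : ∀ n, Measurable (Z n)) (hW_indep : iIndepFun W P) (hW_one : ∀ᵐ ω ∂P, W 0 ω = 1)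
    (hW_beta : ∀ n : ℕ, 1 ≤ n → HasLaw (W n) (betaMeasure 1 n) P) (hZ_exch : Exchangeable Z P)
    (hWZ : IndepFun (fun ω n => W n ω) (fun ω n => Z n ω) P) {f : X → ℝ} (hf : Measurable f)
    (hf01 : ∀ x, f x ∈ Set.Icc 0 1) {n : ℕ} (hn : 1 ≤ n) :
    ∫ ω, (mixingAverage f (fun k => W k ω) (fun k => Z k ω) n -
      seqAverage f n fun k => Z k ω) ^ 2 ∂P ≤ (n : ℝ)⁻¹ := by
  have h01 := ae_forall_mem_Icc_of_hasLaw_beta hW_one hW_beta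
  have hn' : (1 : ℝ) ≤ n := by exact_mod_cast hn
  have hn0 : (n : ℝ) ≠ 0 := by positivity
  have hn1 : (n : ℝ)⁻¹ ≤ 1 := inv_le_one_of_one_le₀ hn'
  have hn2 : 0 ≤ (n : ℝ)⁻¹ := by positivity
  have hmW : Measurable fun w : ℕ → ℝ => fun i : Fin n => mixingWeights w n i - (n : ℝ)⁻¹ :=
    (measurable_mixingWeights n).sub_const (fun _ => (n : ℝ)⁻¹)
  have hWm : Measurable fun ω k => W k ω := measurable_pi_lambda _ hW
  set a : Fin n → Ω → ℝ := fun i ω => mixingWeights (fun k => W k ω) n i - (n : ℝ)⁻¹ with ha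
  have hsum1 : ∀ᵐ ω ∂P, ∑ i, mixingWeights (fun k => W k ω) n i = 1 := by
    filter_upwards [hW_one] with ω hω using sum_mixingWeights hω hn
  have key := hZ_exch.integral_sq_sum_le hZ hf hf01 (a := a)
    (fun i => (measurable_pi_apply i).comp (hmW.comp hWm)) ?_ (hWZ.comp hmW measurable_id) ?_
  · refine le_trans (le_of_eq ?_) (key.trans ?_)
    · congr 1
      funext ω
      congr 1
      simp only [ha, sub_mul, Finset.sum_sub_distrib, mixingAverage, seqAverage, Finset.mul_sum]
      rw [Fin.sum_univ_eq_sum_range (fun i => (n : ℝ)⁻¹ * f (Z i ω)) n]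
    · have e : ∀ᵐ ω ∂P, ∑ i, a i ω ^ 2 =
          ∑ i, mixingWeights (fun k => W k ω) n i ^ 2 - (n : ℝ)⁻¹ := by
        filter_upwards [hsum1] with ω hω
        simp only [ha, sub_sq, Finset.sum_add_distrib, Finset.sum_sub_distrib, ← Finset.sum_mul,
          ← Finset.mul_sum, hω]
        simp
        field_simp
        ring
      rw [integral_congr_ae e, integral_sub (integrable_sum_sq_mixingWeights hW h01 n)
        (integrable_const _), integral_sum_sq_mixingWeights hW hW_indep hW_one hW_beta hn]
      simp only [integral_const, probReal_univ, one_smul]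
      have : 2 / ((n : ℝ) + 1) ≤ 2 * (n : ℝ)⁻¹ := by
        rw [← div_eq_mul_inv]
        exact div_le_div_of_nonneg_left zero_le_two (by positivity) (by linarith)
      linarith
  · filter_upwards [h01] with ω hω i
    have h1 := abs_mixingWeights_le_one hω n i
    rw [abs_of_nonneg (mixingWeights_nonneg hω n i)] at h1
    have h2 := mixingWeights_nonneg hω n i
    exact abs_le.2 ⟨by simp only [ha]; linarith, by simp only [ha]; linarith⟩
  · filter_upwards [hsum1] with ω hω
    simp only [ha, Finset.sum_sub_distrib, hω]
    simp [hn0]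

theorem ae_tendsto_mixingAverage (hW : ∀ n, Measurable (W n))
    (hZ : ∀ n, Measurable (Z n)) (hW_indep : iIndepFun W P) (hW_one : ∀ᵐ ω ∂P, W 0 ω = 1)
    (hW_beta : ∀ n : ℕ, 1 ≤ n → HasLaw (W n) (betaMeasure 1 n) P) (hZ_exch : Exchangeable Z P)
    (hWZ : IndepFun (fun ω n => W n ω) (fun ω n => Z n ω) P) {f : X → ℝ} (hf : Measurable f)
    (hf01 : ∀ x, f x ∈ Set.Icc 0 1) {L : Ω → ℝ}
    (hL : ∀ᵐ ω ∂P, Tendsto (fun j : ℕ => seqAverage f ((j + 1) ^ 4) fun k => Z k ω) atTop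
      (𝓝 (L ω))) :
    ∀ᵐ ω ∂P, Tendsto (mixingAverage f (fun k => W k ω) fun k => Z k ω) atTop (𝓝 (L ω)) := by
  have h01 := ae_forall_mem_Icc_of_hasLaw_beta hW_one hW_beta
  set D : ℕ → Ω → ℝ := fun j ω => mixingAverage f (fun k => W k ω) (fun k => Z k ω) ((j + 1) ^ 4) -
      seqAverage f ((j + 1) ^ 4) fun k => Z k ω with hD
  have hDm : ∀ j, Measurable (D j) := fun j => by
    refine Measurable.sub (Finset.measurable_sum _ fun i _ => Measurable.mul ?_ (hf.comp (hZ i)))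
      ((measurable_seqAverage hf _).comp (measurable_pi_lambda _ hZ))
    exact (measurable_pi_apply i).comp
      ((measurable_mixingWeights _).comp (measurable_pi_lambda _ hW))
  have hDint : ∀ j, Integrable (fun ω => D j ω ^ 2) P := fun j => by
    refine integrable_of_measurable_of_abs_le (C := 1) ((hDm j).pow_const 2) ?_
    filter_upwards [h01] with ω hω
    have h1 := mixingAverage_mem_Icc hf01 hω (fun k => Z k ω) ((j + 1) ^ 4)
    have h2 := seqAverage_mem_Icc hf01 ((j + 1) ^ 4) fun k => Z k ω
    rw [abs_pow]
    refine pow_le_one₀ (abs_nonneg _) (abs_le.2 ⟨?_, ?_⟩) <;> simp only [hD] <;>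
      linarith [h1.1, h1.2, h2.1, h2.2]
  have hle : ∀ j : ℕ, ∫ ω, D j ω ^ 2 ∂P ≤ 1 / ((j : ℝ) + 1) ^ 2 := fun j => by
    refine (integral_sq_mixingAverage_sub_le hW hZ hW_indep hW_one hW_beta hZ_exch hWZ hf hf01
      (Nat.one_le_pow 4 _ (Nat.succ_pos j))).trans ?_
    rw [← one_div]
    push_cast
    exact one_div_le_one_div_of_le (by positivity)
      (pow_le_pow_right₀ (by linarith [Nat.cast_nonneg (α := ℝ) j]) (by norm_num))
  have hsum : Summable fun j : ℕ => ∫ ω, D j ω ^ 2 ∂P :=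
    Summable.of_nonneg_of_le (fun j => integral_nonneg fun _ => sq_nonneg _) hle
      summable_one_div_add_one_sq
  filter_upwards [h01, hL, ae_tendsto_sum_Ico_of_hasLaw_beta hW hW_one hW_beta,
    ae_summable_of_summable_integral hDint (fun j => Eventually.of_forall fun _ => sq_nonneg _)
      hsum] with ω hω hLω hbω hDω
  have hD0 : Tendsto (fun j => D j ω) atTop (𝓝 0) := by
    have h0 := (Real.continuous_sqrt.tendsto 0).comp hDω.tendsto_atTop_zero
    rw [Real.sqrt_zero] at h0
    exact squeeze_zero_norm (fun j => Real.abs_le_sqrt le_rfl) h0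
  refine tendsto_of_tendsto_pow_four ?_ hbω fun j n h1 h2 => ?_
  · simpa [hD] using hD0.add hLω
  · refine (abs_mixingAverage_sub_le hf01 hω (fun k => Z k ω) h1).trans ?_
    exact Finset.sum_le_sum_of_subset_of_nonneg (Finset.Ico_subset_Ico le_rfl h2)
      fun k _ _ => (hω k).1

end Beta

theorem real_sum_smul_dirac {X : Type*} [MeasurableSpace X] {w : ℕ → ℝ}
    (hw : ∀ k, 0 ≤ w k ∧ w k ≤ 1) (z : ℕ → X) (n : ℕ) {A : Set X} (hA : MeasurableSet A) :
    (∑ i : Fin n, ENNReal.ofReal (mixingWeights w n i) • Measure.dirac (z i)).real A =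
      mixingAverage (A.indicator fun _ => 1) w z n := by
  rw [Measure.real, Measure.finsetSum_apply, ENNReal.toReal_sum]
  · refine Finset.sum_congr rfl fun i _ => ?_
    rw [Measure.smul_apply, smul_eq_mul, ENNReal.toReal_mul,
      ENNReal.toReal_ofReal (mixingWeights_nonneg hw n i), Measure.dirac_apply' _ hA]
    by_cases h : z i ∈ A <;> simp [h]
  · intro i _
    rw [Measure.smul_apply, smul_eq_mul]
    exact ENNReal.mul_ne_top ENNReal.ofReal_ne_top (measure_ne_top _ _)

/-! ### Uniqueness of the de Finetti measure -/

open BoundedContinuousFunction in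
/-- Measures on a cube are determined by their mixed moments. -/
theorem ext_of_forall_integral_list_prod_eq {ι : Type*} [Fintype ι]
    {μ ν : Measure (ι → Set.Icc (0 : ℝ) 1)} [IsFiniteMeasure μ] [IsFiniteMeasure ν]
    (h : ∀ l : List ι, ∫ x, (l.map fun i => (x i : ℝ)).prod ∂μ =
      ∫ x, (l.map fun i => (x i : ℝ)).prod ∂ν) : μ = ν := by
  set c : ι → ((ι → Set.Icc (0 : ℝ) 1) →ᵇ ℝ) := fun i => mkOfCompact ⟨fun x => (x i : ℝ), by fun_prop⟩
    with hc
  set A : StarSubalgebra ℝ ((ι → Set.Icc (0 : ℝ) 1) →ᵇ ℝ) :=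
    { Algebra.adjoin ℝ (Set.range c) with
      star_mem' := fun {a} ha => by
        have : star a = a := by ext x; simp
        rwa [this] } with hA
  have hcA : ∀ i, c i ∈ A := fun i => Algebra.subset_adjoin ⟨i, rfl⟩
  -- Stone–Weierstrass: the coordinates separate points, so the algebra they generate determines the
  -- measure; by linearity only monomials, listed with repetition, need checking.
  refine ext_of_forall_mem_subalgebra_integral_eq_of_polish (𝕜 := ℝ) (A := A) ?_ fun g hg => ?_
  · intro x y hxy
    obtain ⟨i, hi⟩ := Function.ne_iff.1 hxy
    refine ⟨c i, ⟨toContinuousMapStarₐ ℝ (c i), ⟨c i, hcA i, rfl⟩, rfl⟩, ?_⟩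
    simpa [hc, Subtype.ext_iff] using hi
  · have hg' : g ∈ Submodule.span ℝ (Submonoid.closure (Set.range c) : Set _) := by
      rw [← Algebra.adjoin_eq_span]
      exact hg
    clear hg
    induction hg' using Submodule.span_induction with
    | mem g hg =>
      have : ∃ l : List ι, ∀ x, g x = (l.map fun i => (x i : ℝ)).prod := by
        induction hg using Submonoid.closure_induction with
        | mem g hg =>
          obtain ⟨i, rfl⟩ := hg
          exact ⟨[i], fun x => by simp [hc]⟩
        | one => exact ⟨[], fun x => by simp⟩
        | mul a b _ _ ha hb =>
          obtain ⟨l, hl⟩ := ha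
          obtain ⟨l', hl'⟩ := hb
          exact ⟨l ++ l', fun x => by simp [hl, hl']⟩
      obtain ⟨l, hl⟩ := this
      simp_rw [hl]
      exact h l
    | zero => simp
    | add a b _ _ ha hb =>
      simp only [BoundedContinuousFunction.coe_add, Pi.add_apply]
      rw [integral_add (a.integrable _) (b.integrable _), integral_add (a.integrable _)
        (b.integrable _), ha, hb]
    | smul r a _ ha =>
      simp only [BoundedContinuousFunction.coe_smul, integral_const_mul, smul_eq_mul, ha]

/-- The values of a probability measure on all measurable sets. -/
noncomputable def evalIcc {X : Type*} [MeasurableSpace X] (μ : ProbabilityMeasure X)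
    (A : {A : Set X // MeasurableSet A}) : Set.Icc (0 : ℝ) 1 :=
  ⟨(μ : Measure X).real A, measureReal_nonneg, measureReal_le_one⟩

theorem measurable_evalIcc {X : Type*} [MeasurableSpace X] :
    Measurable (evalIcc (X := X)) :=
  measurable_pi_lambda _ fun A =>
    (((Measure.measurable_coe A.2).comp measurable_subtype_coe).ennreal_toReal).subtype_mk

/-- Allows laws on `ProbabilityMeasure X` to be compared after transport to a product of unit
intervals. -/
theorem comap_evalIcc {X : Type*} [MeasurableSpace X] :
    (inferInstance : MeasurableSpace (ProbabilityMeasure X)) ≤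
      MeasurableSpace.comap (evalIcc (X := X)) MeasurableSpace.pi := by
  have h : @Measurable _ _ (MeasurableSpace.comap (evalIcc (X := X)) MeasurableSpace.pi) _
      fun μ : ProbabilityMeasure X => (μ : Measure X) := by
    let : MeasurableSpace (ProbabilityMeasure X) :=
      MeasurableSpace.comap (evalIcc (X := X)) MeasurableSpace.pi
    refine Measure.measurable_of_measurable_coe _ fun A hA => ?_
    have e : (fun μ : ProbabilityMeasure X => (μ : Measure X) A) =
        fun μ => ENNReal.ofReal (evalIcc μ ⟨A, hA⟩) := by
      funext μ
      simp [evalIcc]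
    rw [e]
    have h1 : Measurable (evalIcc (X := X)) := comap_measurable _
    have h2 : Measurable fun v : {A : Set X // MeasurableSet A} → Set.Icc (0 : ℝ) 1 =>
        ENNReal.ofReal (v ⟨A, hA⟩) := by fun_prop
    exact h2.comp h1
  exact measurable_iff_comap_le.1 h

/-- The law of a random probability measure is determined by the mixed moments of its values. -/
theorem ext_of_forall_lintegral_prod_measure_eq {X : Type*} [MeasurableSpace X]
    {ν ν' : Measure (ProbabilityMeasure X)} [IsProbabilityMeasure ν] [IsProbabilityMeasure ν']
    (h : ∀ (n : ℕ) (A : Fin n → Set X), (∀ i, MeasurableSet (A i)) →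
      ∫⁻ μ, ∏ i, (μ : Measure X) (A i) ∂ν = ∫⁻ μ, ∏ i, (μ : Measure X) (A i) ∂ν') : ν = ν' := by
  have hmap : ν.map evalIcc = ν'.map evalIcc := by
    refine IsProjectiveLimit.unique (P := fun I => (ν'.map evalIcc).map
      (I.restrict (π := fun _ => Set.Icc (0 : ℝ) 1))) (fun I => ?_) fun I => rfl
    have hres := Finset.measurable_restrict (X := fun _ : {A : Set X // MeasurableSet A} => Set.Icc (0 : ℝ) 1) I
    refine ext_of_forall_integral_list_prod_eq fun l => ?_
    have hl : Measurable fun x : I → Set.Icc (0 : ℝ) 1 => (l.map fun i => (x i : ℝ)).prod := by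
      simp_rw [← Fin.prod_univ_fun_getElem]
      fun_prop
    have key : ∀ ρ : Measure (ProbabilityMeasure X),
        ∫ x, (l.map fun i => (x i : ℝ)).prod
            ∂((ρ.map evalIcc).map (I.restrict (π := fun _ => Set.Icc (0 : ℝ) 1))) =
          (∫⁻ μ, ∏ i : Fin l.length, (μ : Measure X) (l[i] : {A : Set X // MeasurableSet A}) ∂ρ).toReal := by
      intro ρ
      rw [Measure.map_map hres measurable_evalIcc,
        integral_map (hres.comp measurable_evalIcc).aemeasurable hl.aestronglyMeasurable,
        ← integral_toReal]
      · congr 1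
        funext μ
        rw [ENNReal.toReal_prod, ← Fin.prod_univ_fun_getElem]
        rfl
      · exact (Finset.measurable_prod _ fun i _ =>
          (Measure.measurable_coe l[i].1.2).comp measurable_subtype_coe).aemeasurable
      · exact Eventually.of_forall fun μ => (ENNReal.prod_ne_top fun i _ => measure_ne_top _ _).lt_top
    -- A monomial in the evaluations is a product over a finite family of sets with repetitions, as
    -- covered by `h`.
    rw [key, key, h _ _ fun i => l[i].1.2]
  ext C hC
  obtain ⟨B, hB, rfl⟩ := comap_evalIcc C hC
  rw [← Measure.map_apply measurable_evalIcc hB, hmap, Measure.map_apply measurable_evalIcc hB]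

theorem IsDeFinettiMeasure.unique {Ω X : Type*} [MeasurableSpace Ω] [MeasurableSpace X]
    {ν ν' : Measure (ProbabilityMeasure X)} {Z : ℕ → Ω → X} {P : Measure Ω}
    (h : IsDeFinettiMeasure ν Z P) (h' : IsDeFinettiMeasure ν' Z P) : ν = ν' := by
  have := h.isProbabilityMeasure
  have := h'.isProbabilityMeasure
  exact ext_of_forall_lintegral_prod_measure_eq fun n A hA => by
    rw [← h.measure_eq n A hA, h'.measure_eq n A hA]

/-! ### The main theorem -/

theorem theorem1 {Ω X : Type*} [MeasurableSpace Ω] (P : Measure Ω) [IsProbabilityMeasure P]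
    [TopologicalSpace X] [PolishSpace X] [MeasurableSpace X] [BorelSpace X]
    -- sequences are indexed from `0`: `W n`, `Z n` are the `(n + 1)`-st terms
    (W : ℕ → Ω → ℝ) (Z : ℕ → Ω → X)
    (hW : ∀ n, Measurable (W n)) (hZ : ∀ n, Measurable (Z n))
    (hW_indep : iIndepFun W P)
    (hW_one : ∀ᵐ ω ∂P, W 0 ω = 1)
    (hW_beta : ∀ n : ℕ, 1 ≤ n → HasLaw (W n) (betaMeasure 1 n) P)
    (hZ_exch : Exchangeable Z P)
    (hWZ : IndepFun (fun ω n => W n ω) (fun ω n => Z n ω) P)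
    -- `Q n` is the `n`-th term of the chain for `n ≥ 1`; `Q 0` is arbitrary
    (Q : ℕ → Ω → ProbabilityMeasure X)
    (hQ : ∀ᵐ ω ∂P, ∀ n : ℕ, (Q (n + 1) ω : Measure X) =
      ENNReal.ofReal (W n ω) • Measure.dirac (Z n ω) +
        ENNReal.ofReal (1 - W n ω) • (Q n ω : Measure X)) :
    -- (i)
    (∃ q : (n : ℕ) → Ω → Fin n → ℝ,
      (∀ n ω, q n ω = mixingWeights (fun k => W k ω) n) ∧
      (∀ᵐ ω ∂P, ∀ n : ℕ, 1 ≤ n →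
        (∀ i, 0 ≤ q n ω i) ∧ ∑ i, q n ω i = 1 ∧
        (Q n ω : Measure X) = ∑ i : Fin n, ENNReal.ofReal (q n ω i) • Measure.dirac (Z i ω)) ∧
      (∀ n : ℕ, 1 ≤ n → HasLaw (q n) (dirichletMeasure fun _ : Fin n => 1) P) ∧
      IndepFun (fun ω n => q n ω) (fun ω n => Z n ω) P) ∧
    -- (ii)
    (∃ Qlim : Ω → ProbabilityMeasure X, Measurable Qlim ∧
      (∀ᵐ ω ∂P, Tendsto (fun n => Q n ω) atTop (𝓝 (Qlim ω))) ∧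
      IsDeFinettiMeasure (P.map Qlim) Z P ∧
      ∀ ν : Measure (ProbabilityMeasure X), IsDeFinettiMeasure ν Z P → ν = P.map Qlim) := by
  have h01 := ae_forall_mem_Icc_of_hasLaw_beta hW_one hW_beta
  have hWm : Measurable fun ω n => W n ω := measurable_pi_lambda _ hW
  have hQsum : ∀ᵐ ω ∂P, ∀ n : ℕ, 1 ≤ n → (Q n ω : Measure X) = ∑ i : Fin n,
      ENNReal.ofReal (mixingWeights (fun k => W k ω) n i) • Measure.dirac (Z i ω) := by
    filter_upwards [h01, hW_one, hQ] with ω h1 h2 h3 n hn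
    exact eq_sum_mixingWeights_dirac (m := fun n => (Q n ω : Measure X)) (z := fun k => Z k ω)
      h1 h2 h3 hn
  refine ⟨⟨fun n ω => mixingWeights (fun k => W k ω) n, fun _ _ => rfl, ?_, fun n hn =>
    hasLaw_mixingWeights hW hW_indep hW_one hW_beta hn, ?_⟩, ?_⟩
  · filter_upwards [h01, hW_one, hQsum] with ω h1 h2 h3 n hn
    exact ⟨mixingWeights_nonneg h1 n, sum_mixingWeights h2 hn, h3 n hn⟩
  · exact hWZ.comp (φ := fun w n => mixingWeights w n)
      (measurable_pi_lambda _ measurable_mixingWeights) measurable_id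
  · obtain ⟨κ, hκ, hdF, hlim⟩ := hZ_exch.exists_directing hZ
    refine ⟨κ, hκ, ?_, hdF, fun ν hν => hν.unique hdF⟩
    have := (TopologicalSpace.countable_countableBasis X).to_subtype
    have hsm : ∀ s : Finset (TopologicalSpace.countableBasis X),
        MeasurableSet (⋃ i ∈ s, (i : Set X)) := fun s =>
      Finset.measurableSet_biUnion _ fun i _ =>
        (TopologicalSpace.isOpen_of_mem_countableBasis i.2).measurableSet
    -- There are countably many finite unions of basis sets, so one null set serves them all.
    have hconv := ae_all_iff.2 fun s : Finset (TopologicalSpace.countableBasis X) =>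
      ae_tendsto_mixingAverage hW hZ hW_indep hW_one hW_beta hZ_exch hWZ
        (measurable_const.indicator (hsm s)) (indicator_one_mem_Icc _) (hlim _ (hsm s))
    filter_upwards [h01, hQsum, hconv] with ω h1 h2 h3
    refine tendsto_probabilityMeasure_of_tendsto_real_biUnion fun s => ?_
    refine (h3 s).congr' ?_
    -- `Q 0` is arbitrary, so the formula is available only from `n = 1` on.
    filter_upwards [eventually_ge_atTop 1] with n hn
    rw [h2 n hn, real_sum_smul_dirac h1 (fun k => Z k ω) n (hsm s)]
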